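/- **Setting.** Let $\mathcal C$ be the class of unit loops: closed curves $\gamma:[0,1]\to\mathbb R^3$, $\gamma(0)=\gamma(1)$, that are Lipschitz with $|\gamma'|=1$ almost everywhere, pass through the origin, and whose image has one-dimensional Hausdorff measure $1$. A loop is simple if $\gamma|_{[0,1)}$ is injective, and smooth if its $1$-periodic extension is $C^\infty$. For $s,t\in[0,1]$ put $d_\gamma(s,t)=\min\{|s-t|,1-|s-t|\}$. $C^1([0,1])$, $C^1$-convergence and $\|\gamma\|_{C^{1,\alpha}}=\sup|\gamma|+\sup|\gamma'|+\sup_{s\ne t}|\gamma'(s)-\gamma'(t)|/|s-t|^\alpha$ refer to the closed interval $[0,1]$. Knot types are classes of subsets of $\mathbb R^3$ under (continuous) ambient isotopy; a knot class is the class of the image of a smooth regular simple closed curve. A *proper arc* of $\gamma$ in a closed round ball is a simple subarc of $\gamma$ (possibly running through $\gamma(0)=\gamma(1)$) whose endpoints lie on the boundary sphere and whose other points lie in the open ball; other strands of $\gamma$ may meet the ball. Such an arc is *non-trivially knotted* if the pair (ball, arc) is not ambient isotopic to a round ball with one of its diameters, and two such arcs have the same knot type if the pairs (ball, arc) are ambient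 isotopic. A sequence $\gamma_i\in\mathcal C$ exhibits the *pull-tight phenomenon* if the $\gamma_i$ contain non-trivially knotted proper arcs, all of the same knot type, in closed balls with radii $r_i\to0$. A functional $\mathscr E:\mathcal C\to(-\infty,\infty]$ is - *self-repulsive* (*charge*) if it is finite on all simple smooth loops and $\mathscr E(\gamma_i)\to+\infty$ for all sequences of simple loops $\gamma_i\in\mathcal C$ converging uniformly on $[0,1]$ to a limit curve $c$ with $c(s)=c(t)$ for some $s\neq t$ in $[0,1)$; - *minimizable* if each knot class contains a simple loop of $\mathcal C$ that minimizes $\mathscr E$ among all simple loops of $\mathcal C$ in that class; - *tight* if $\mathscr E(\gamma_i)\to+\infty$ for all sequences in $\mathcal C$ with the pull-tight phenomenon; - *strong* if for each $E\in\mathbb R$ only finitely many knot types are represented by simple loops $\gamma\in\mathcal C$ with $\mathscr E(\gamma)\le E$. **Theorem.** Let $\mathscr E:\mathcal C\to(-\infty,\infty]$ be bounded from below and such that (i) for each $E\in\mathbb R$ there is $\delta=\delta(E)>0$ such that for all $\gamma\in\mathcal C$ with $\mathscr E(\gamma)<E$ and all $s,t\in[0,1]$ with $d_\gamma(s,t)>0$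 $$|\gamma(s)-\gamma(t)|>\min\{\delta,\tfrac12 d_\gamma(s,t)\};$$ (ii) $\mathscr E$ is sequentially lower semicontinuous on $\mathcal C\cap C^1([0,1],\mathbb R^3)$ with respect to $C^1$-convergence; (iii) for each $E\in\mathbb R$ there are constants $C=C(E)$ and $\alpha=\alpha(E)\in(0,1]$ such that every $\gamma\in\mathcal C$ with $\mathscr E(\gamma)\le E$ is of class $C^{1,\alpha}([0,1],\mathbb R^3)$ with $\|\gamma\|_{C^{1,\alpha}}\le C$. Then $\mathscr E(\gamma_i)\to+\infty$ along every sequence of simple loops converging uniformly to a curve with a self-intersection, so that $\mathscr E$ is charge provided it is finite on all simple smooth loops. Moreover, $\mathscr E$ is minimizable, tight (even without the requirement that the knotted arcs all have the same knot type), and strong. -/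

import Mathlib

open Set Filter Topology MeasureTheory
open scoped ContDiff NNReal ENNReal

noncomputable section

/-- Euclidean three-space. -/
abbrev R3 : Type := EuclideanSpace ℝ (Fin 3)

/-- The class of unit loops: closed curves `γ : [0,1] → ℝ³`, `γ 0 = γ 1`, parametrized by
arclength (Lipschitz with `|γ'| = 1` almost everywhere), passing through the origin, whose image
has one-dimensional Hausdorff measure `1`.  A loop is stored as its `1`-periodic extension to `ℝ`,
so that a loop on `[0,1]` and its extension determine each other.  (A point where the curve is not
differentiable has `deriv = 0` and hence is excluded by the condition on the speed.) -/
@[ext] structure UnitLoop where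
  toFun : ℝ → R3
  periodic : Function.Periodic toFun 1
  lipschitz : LipschitzWith 1 toFun
  unit_speed : ∀ᵐ s : ℝ, ‖deriv toFun s‖ = 1
  hausdorff_one : Measure.hausdorffMeasure 1 (range toFun) = 1
  origin_mem : (0 : R3) ∈ range toFun

instance : CoeFun UnitLoop (fun _ => ℝ → R3) := ⟨UnitLoop.toFun⟩

/-- A closed curve (given on `[0,1)`) is simple if it has no self-intersection. -/
def UnitLoop.IsSimple (γ : UnitLoop) : Prop := InjOn γ (Ico (0 : ℝ) 1)

/-- A smooth loop: smooth as a closed curve, i.e. its periodic extension is `C^∞`. -/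
def UnitLoop.IsSmooth (γ : UnitLoop) : Prop := ContDiff ℝ ∞ γ

/-- The curve as a subset of `ℝ³`. -/
def UnitLoop.carrier (γ : UnitLoop) : Set R3 := range γ

/-- Intrinsic distance of the parameters `s, t ∈ [0,1]` of a unit loop. -/
def intrinsicDist (s t : ℝ) : ℝ := min |s - t| (1 - |s - t|)

/-- Membership in `C¹([0,1], ℝ³)`. -/
def UnitLoop.IsC1 (γ : UnitLoop) : Prop := ContDiffOn ℝ 1 γ (Icc 0 1)

/-- The derivative on `[0,1]` (one-sided at the endpoints). -/
def UnitLoop.der (γ : UnitLoop) (s : ℝ) : R3 := derivWithin γ (Icc 0 1) s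

/-- `‖γ‖_{C^{1,α}([0,1])}`, with values in `[0,∞]`: the sup-norms of `γ` and `γ'` plus the
Hölder seminorm of `γ'`. -/
def UnitLoop.c1aNorm (α : ℝ) (γ : UnitLoop) : ℝ≥0∞ :=
  (⨆ s ∈ Icc (0 : ℝ) 1, ‖γ s‖ₑ) + (⨆ s ∈ Icc (0 : ℝ) 1, ‖γ.der s‖ₑ) +
    ⨆ s ∈ Icc (0 : ℝ) 1, ⨆ t ∈ Icc (0 : ℝ) 1, ⨆ _ : s ≠ t,
      ‖γ.der s - γ.der t‖ₑ / ENNReal.ofReal (|s - t| ^ α)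

/-- Convergence in `C¹([0,1], ℝ³)`. -/
def TendstoC1 (γs : ℕ → UnitLoop) (γ : UnitLoop) : Prop :=
  TendstoUniformlyOn (fun i => (γs i).toFun) γ.toFun atTop (Icc 0 1) ∧
    TendstoUniformlyOn (fun i => (γs i).der) γ.der atTop (Icc 0 1)

/-- An ambient isotopy of `ℝ³`: a jointly continuous family of homeomorphisms of `ℝ³`,
indexed by `[0,1]`, that starts at the identity. -/
structure AmbientIsotopy where
  H : unitInterval → (R3 ≃ₜ R3)
  continuous_uncurry : Continuous (fun p : unitInterval × R3 => H p.1 p.2)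
  H_zero : H 0 = Homeomorph.refl R3

/-- Two subsets of `ℝ³` are ambient isotopic. -/
def AmbientIsotopic (K L : Set R3) : Prop := ∃ Φ : AmbientIsotopy, Φ.H 1 '' K = L

/-- Two pairs of subsets of `ℝ³` are ambient isotopic as pairs. -/
def PairAmbientIsotopic (B A B' A' : Set R3) : Prop :=
  ∃ Φ : AmbientIsotopy, Φ.H 1 '' B = B' ∧ Φ.H 1 '' A = A'

theorem AmbientIsotopic.refl (K : Set R3) : AmbientIsotopic K K :=
  ⟨⟨fun _ => Homeomorph.refl R3, continuous_snd, rfl⟩, by simp⟩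

theorem AmbientIsotopic.symm {K L : Set R3} (h : AmbientIsotopic K L) : AmbientIsotopic L K := by
  obtain ⟨Φ, rfl⟩ := h
  refine ⟨⟨fun t => (Φ.H 1).symm.trans (Φ.H (unitInterval.symm t)), ?_, ?_⟩, ?_⟩
  · exact Φ.continuous_uncurry.comp
      ((unitInterval.continuous_symm.comp continuous_fst).prodMk
        ((Φ.H 1).symm.continuous.comp continuous_snd))
  · ext1 x; simp
  · simp [Φ.H_zero, image_image]

theorem AmbientIsotopic.trans {K L M : Set R3} (h : AmbientIsotopic K L)
    (h' : AmbientIsotopic L M) : AmbientIsotopic K M := by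
  obtain ⟨Φ, rfl⟩ := h
  obtain ⟨Ψ, rfl⟩ := h'
  refine ⟨⟨fun t => (Φ.H t).trans (Ψ.H t), ?_, ?_⟩, ?_⟩
  · exact Ψ.continuous_uncurry.comp (continuous_fst.prodMk Φ.continuous_uncurry)
  · ext1 x; simp [Φ.H_zero, Ψ.H_zero]
  · exact image_comp (Ψ.H 1) (Φ.H 1) K

/-- Ambient isotopy as an equivalence relation on subsets of `ℝ³`. -/
instance ambientIsotopySetoid : Setoid (Set R3) where
  r := AmbientIsotopic
  iseqv := ⟨AmbientIsotopic.refl, AmbientIsotopic.symm, AmbientIsotopic.trans⟩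

/-- Ambient isotopy classes of subsets of `ℝ³`. -/
abbrev IsotopyClass : Type := Quotient ambientIsotopySetoid

/-- The knot type of a (simple) loop. -/
def UnitLoop.knotType (γ : UnitLoop) : IsotopyClass := Quotient.mk _ γ.carrier

/-- Smooth knots: images of smooth regular simple closed curves, of any length and position. -/
def IsSmoothKnot (K : Set R3) : Prop :=
  ∃ c : ℝ → R3, ContDiff ℝ ∞ c ∧ Function.Periodic c 1 ∧ InjOn c (Ico (0 : ℝ) 1) ∧
    (∀ s, deriv c s ≠ 0) ∧ K = range c

/-- A (tame) knot class: the ambient isotopy class of a smooth knot. -/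
def IsKnotClass (κ : IsotopyClass) : Prop :=
  ∃ K : Set R3, IsSmoothKnot K ∧ κ = Quotient.mk _ K

/-- `γ([a,b])` is a simple arc of the loop `γ`, properly embedded in the round ball with centre `x`
and radius `r`: its endpoints lie on the boundary sphere, all other points in the open ball.
The parameters live on `ℝ`, so the arc may run through `γ 0 = γ 1`. -/
def UnitLoop.IsProperArc (γ : UnitLoop) (a b : ℝ) (x : R3) (r : ℝ) : Prop :=
  0 < r ∧ a < b ∧ b < a + 1 ∧ InjOn γ (Icc a b) ∧
    γ a ∈ Metric.sphere x r ∧ γ b ∈ Metric.sphere x r ∧ γ '' Ioo a b ⊆ Metric.ball x r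

/-- A ball-arc pair `(B, A)` is trivial if it is ambient isotopic, as a pair, to a round ball
together with one of its diameters. -/
def IsTrivialBallArc (B A : Set R3) : Prop :=
  ∃ (x : R3) (r : ℝ) (u : R3), 0 < r ∧ ‖u‖ = 1 ∧
    PairAmbientIsotopic B A (Metric.closedBall x r) (segment ℝ (x - r • u) (x + r • u))

/-- The arcs `A_i = γ_i([a_i,b_i])` are non-trivially knotted in round balls `B_{r_i}(x_i)` whose
radii tend to `0`.  Other strands of `γ_i` are allowed to pass through the balls. -/
def HasShrinkingKnottedArcs (γs : ℕ → UnitLoop) (a b : ℕ → ℝ) (x : ℕ → R3) (r : ℕ → ℝ) : Prop :=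
  Tendsto r atTop (𝓝 0) ∧
    (∀ i, (γs i).IsProperArc (a i) (b i) (x i) (r i)) ∧
    ∀ i, ¬ IsTrivialBallArc (Metric.closedBall (x i) (r i)) (γs i '' Icc (a i) (b i))

/-- The pull-tight phenomenon: the loops `γ_i` contain arcs `A_i`, non-trivially knotted in round
balls whose radii tend to `0`, all of the same knot type (as knotted arcs in balls). -/
def IsPullTight (γs : ℕ → UnitLoop) : Prop :=
  ∃ (a b : ℕ → ℝ) (x : ℕ → R3) (r : ℕ → ℝ), HasShrinkingKnottedArcs γs a b x r ∧
    ∀ i j, PairAmbientIsotopic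
      (Metric.closedBall (x i) (r i)) (γs i '' Icc (a i) (b i))
      (Metric.closedBall (x j) (r j)) (γs j '' Icc (a j) (b j))

/-- `𝓔` is finite on all simple smooth loops. -/
def IsFiniteOnSmooth (𝓔 : UnitLoop → EReal) : Prop :=
  ∀ γ : UnitLoop, γ.IsSimple → γ.IsSmooth → 𝓔 γ ≠ ⊥ ∧ 𝓔 γ ≠ ⊤

/-- `𝓔` blows up along every sequence of simple loops that converges uniformly to a limit curve
with at least one self-intersection (the limit curve need not be a unit loop). -/
def BlowsUpAtSelfIntersections (𝓔 : UnitLoop → EReal) : Prop :=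
  ∀ (γs : ℕ → UnitLoop) (c : ℝ → R3), (∀ i, (γs i).IsSimple) →
    TendstoUniformlyOn (fun i => (γs i).toFun) c atTop (Icc 0 1) →
    (∃ s ∈ Ico (0 : ℝ) 1, ∃ t ∈ Ico (0 : ℝ) 1, s ≠ t ∧ c s = c t) →
    Tendsto (fun i => 𝓔 (γs i)) atTop (𝓝 ⊤)

/-- `𝓔` is charge (self-repulsive). -/
def IsCharge (𝓔 : UnitLoop → EReal) : Prop :=
  IsFiniteOnSmooth 𝓔 ∧ BlowsUpAtSelfIntersections 𝓔

/-- `𝓔` is minimizable: each knot class has a representative among the unit loops that minimizes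
`𝓔` within the knot class. -/
def IsMinimizable (𝓔 : UnitLoop → EReal) : Prop :=
  ∀ κ : IsotopyClass, IsKnotClass κ →
    ∃ γ : UnitLoop, γ.IsSimple ∧ γ.knotType = κ ∧
      ∀ β : UnitLoop, β.IsSimple → β.knotType = κ → 𝓔 γ ≤ 𝓔 β

/-- `𝓔` is tight: it tends to `+∞` on every sequence with a pull-tight phenomenon. -/
def IsTight (𝓔 : UnitLoop → EReal) : Prop :=
  ∀ γs : ℕ → UnitLoop, IsPullTight γs → Tendsto (fun i => 𝓔 (γs i)) atTop (𝓝 ⊤)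

/-- The form of tightness in which the knotted arcs need not have a fixed knot type. -/
def IsTightForAllKnottedArcs (𝓔 : UnitLoop → EReal) : Prop :=
  ∀ (γs : ℕ → UnitLoop) (a b : ℕ → ℝ) (x : ℕ → R3) (r : ℕ → ℝ),
    HasShrinkingKnottedArcs γs a b x r → Tendsto (fun i => 𝓔 (γs i)) atTop (𝓝 ⊤)

/-- `𝓔` is strong: there are only finitely many knot types under each energy level. -/
def IsStrong (𝓔 : UnitLoop → EReal) : Prop :=
  ∀ e : ℝ, {κ : IsotopyClass | ∃ γ : UnitLoop, γ.IsSimple ∧ 𝓔 γ ≤ (e : EReal) ∧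
    γ.knotType = κ}.Finite

end

/-!
Everything rests on two facts about a loop that is `C^{1,α}` on `[0,1]` and satisfies the separation
bound `|γ(s) - γ(t)| > min {δ, d/2}`. Note that such a loop may have a corner at its base point.

*Isotopy.* The separation bound makes such loops uniformly bi-Lipschitz embeddings of the circle.
Hence, if `β` is `C¹`-close to `γ`, the displacement `γ(s) ↦ β(s) - γ(s)` is a map on the image of
`γ` with a small Lipschitz constant. It extends to a contraction `V` of `ℝ³`, and `id + t V` is an
ambient isotopy from `γ` to `β` (`exists_ambientIsotopic_of_lipschitz_displacement`). Together with
the Arzelà–Ascoli theorem (`UnitLoop.exists_tendstoC1_subseq`), every sequence of bounded energy has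
a subsequence that converges in `C¹` to a simple unit loop of the eventual knot type
(`exists_subseq_of_energy_le`). A minimizing sequence then yields a minimizer by lower
semicontinuity, and a sequence of loops with pairwise different knot types cannot have bounded
energy. That each knot class contains a unit loop is `IsKnotClass.exists_unitLoop`; that the limit
is a unit loop requires its image to have length `1` (`one_le_hausdorffMeasure_image`).

*Unknottedness of short arcs.* By the separation bound a proper arc in a small ball is short, so its
velocity is nearly constant on either side of a possible corner. At the corner the separation bound
keeps the exterior angle at most `120°`. Hence there is a direction `w` in which the arc is
strictly increasing (`UnitLoop.exists_inner_pos`), i.e. each plane `⟨x, w⟩ = h` meets it in at most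
one point. Such an arc is unknotted (`isTrivialBallArc_of_strictMonoOn`): in each plane, cone off
the boundary of the disc cut out of the ball, and move the apex of the cone from the point of the
arc to the point of its chord. With `μ` the cone coordinate, this moves `x` by at most the
displacement of the apex, which gives continuity where the arc reaches the sphere, however
tangentially. The same isotopy, in planes orthogonal to the chord, replaces the chord by the broken
line through the centre, and a norm-preserving map straightens this to a diameter.

The blow-up at self-intersections is immediate from the separation bound.
-/

/-! ### Ambient isotopies -/

theorem PairAmbientIsotopic.trans {B A B' A' B'' A'' : Set R3}
    (h : PairAmbientIsotopic B A B' A') (h' : PairAmbientIsotopic B' A' B'' A'') :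
    PairAmbientIsotopic B A B'' A'' := by
  obtain ⟨Φ, rfl, rfl⟩ := h
  obtain ⟨Ψ, rfl, rfl⟩ := h'
  refine ⟨⟨fun t => (Φ.H t).trans (Ψ.H t), ?_, ?_⟩, ?_, ?_⟩
  · exact Ψ.continuous_uncurry.comp (continuous_fst.prodMk Φ.continuous_uncurry)
  · ext1 x; simp [Φ.H_zero, Ψ.H_zero]
  · exact image_comp (Ψ.H 1) (Φ.H 1) B
  · exact image_comp (Ψ.H 1) (Φ.H 1) A

/-- Similarities `x ↦ v + c • x` with `c > 0` are ends of ambient isotopies. -/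
theorem exists_ambientIsotopy_affine {c : ℝ} (hc : 0 < c) (v : R3) :
    ∃ Φ : AmbientIsotopy, ∀ x, Φ.H 1 x = v + c • x := by
  have hpos : ∀ t : unitInterval, 0 < 1 + (t : ℝ) * (c - 1) := fun t => by
    have h0 := t.2.1
    have h1 := t.2.2
    rcases le_total 1 c with h | h
    · nlinarith [mul_nonneg h0 (sub_nonneg.2 h)]
    · nlinarith [mul_nonneg (sub_nonneg.2 h1) (sub_nonneg.2 h)]
  refine ⟨⟨fun t => (Homeomorph.smulOfNeZero (1 + (t : ℝ) * (c - 1)) (hpos t).ne').trans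
    (Homeomorph.addLeft ((t : ℝ) • v)), ?_, ?_⟩, fun x => ?_⟩
  · change Continuous fun p : unitInterval × R3 =>
      (p.1 : ℝ) • v + (1 + (p.1 : ℝ) * (c - 1)) • p.2
    fun_prop
  · ext1 x; simp
  · simp

/-- A map `id + V` with `V` a contraction is the end of the ambient isotopy `id + t V`. -/
theorem exists_ambientIsotopy_id_add {V : R3 → R3} {K : ℝ≥0} (hV : LipschitzWith K V)
    (hK : K < 1) : ∃ Φ : AmbientIsotopy, ∀ x, Φ.H 1 x = x + V x := by
  have happ : ∀ t : unitInterval, ApproximatesLinearOn (fun x => x + (t : ℝ) • V x)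
      ((ContinuousLinearEquiv.refl ℝ R3 : R3 ≃L[ℝ] R3) : R3 →L[ℝ] R3) univ K := fun t => by
    intro x _ y _
    have h := hV.norm_sub_le x y
    have e : x + (t : ℝ) • V x - (y + (t : ℝ) • V y)
        - ((ContinuousLinearEquiv.refl ℝ R3 : R3 ≃L[ℝ] R3) : R3 →L[ℝ] R3) (x - y)
        = (t : ℝ) • (V x - V y) := by
      simp only [ContinuousLinearEquiv.coe_coe, ContinuousLinearEquiv.refl_apply, smul_sub]
      abel
    rw [e, norm_smul, Real.norm_of_nonneg t.2.1]
    nlinarith [t.2.2, norm_nonneg (V x - V y)]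
  have hc : Subsingleton R3 ∨
      K < ‖((ContinuousLinearEquiv.refl ℝ R3).symm : R3 →L[ℝ] R3)‖₊⁻¹ := by
    right
    have : ‖((ContinuousLinearEquiv.refl ℝ R3).symm : R3 →L[ℝ] R3)‖₊ = 1 := by
      ext
      exact ContinuousLinearMap.norm_id
    rw [this]; simpa using hK
  refine ⟨⟨fun t => (happ t).toHomeomorph _ hc, ?_, ?_⟩, fun x => ?_⟩
  · change Continuous fun p : unitInterval × R3 => p.2 + (p.1 : ℝ) • V p.2
    have := hV.continuous
    fun_prop
  · ext1 x
    change x + ((0 : unitInterval) : ℝ) • V x = x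
    simp
  · change x + ((1 : unitInterval) : ℝ) • V x = x + V x
    simp

/-- If the difference of two curves is Lipschitz with a small constant *with respect to the
chordal distance of the first curve*, the curves are ambient isotopic: the displacement extends
to a contraction of `ℝ³`. -/
theorem exists_ambientIsotopic_of_lipschitz_displacement :
    ∃ ε : ℝ, 0 < ε ∧ ∀ (ι : Type) (f g : ι → R3),
      (∀ s t, ‖(g s - f s) - (g t - f t)‖ ≤ ε * ‖f s - f t‖) →
      AmbientIsotopic (range f) (range g) := by
  set M : ℝ≥0 := lipschitzExtensionConstant R3
  have hM : 0 < M := lipschitzExtensionConstant_pos R3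
  refine ⟨((2 * M)⁻¹ : ℝ≥0), by positivity, fun ι f g hfg => ?_⟩
  set V₀ : R3 → R3 := Function.extend f (fun s => g s - f s) 0
  have hV₀ : ∀ s, V₀ (f s) = g s - f s := fun s => by
    refine Function.FactorsThrough.extend_apply (fun s t hst => ?_) _ s
    have := hfg s t
    rw [hst, sub_self, norm_zero, mul_zero] at this
    rw [hst]
    exact sub_eq_zero.1 (norm_le_zero_iff.1 this)
  have hLip : LipschitzOnWith (2 * M)⁻¹ V₀ (range f) := by
    refine LipschitzOnWith.of_dist_le_mul ?_
    rintro _ ⟨s, rfl⟩ _ ⟨t, rfl⟩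
    rw [dist_eq_norm, dist_eq_norm, hV₀, hV₀]
    exact hfg s t
  obtain ⟨V, hV, hEq⟩ := hLip.extend_finite_dimension
  obtain ⟨Φ, hΦ⟩ := exists_ambientIsotopy_id_add hV (by
    have : lipschitzExtensionConstant R3 * (2 * M)⁻¹ = 2⁻¹ := by
      change M * (2 * M)⁻¹ = 2⁻¹
      field_simp
    rw [this]
    exact inv_lt_one_of_one_lt₀ one_lt_two)
  refine ⟨Φ, ?_⟩
  rw [← range_comp]
  congr 1
  ext1 s
  simp only [Function.comp_apply, hΦ]
  rw [← hEq (mem_range_self s), hV₀]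
  abel

/-! ### Moving a point of the ball by coning off the sphere -/

/-- For `P` in the open unit ball and `x` in the closed unit ball, `coneWeight P x` is the `μ` such
that `x` lies on the sphere of radius `1 - μ` about `μ P`, i.e. `x = μ P + (1 - μ) b` with
`‖b‖ = 1`.  It is the smaller root of a quadratic equation, written with a denominator that does
not vanish, and it is set to `0` outside the ball. -/
noncomputable def coneWeight (P x : R3) : ℝ :=
  max 0 (1 - ‖x‖ ^ 2) /
    ((1 - inner ℝ x P) + √((1 - inner ℝ x P) ^ 2 - (1 - ‖P‖ ^ 2) * (1 - ‖x‖ ^ 2)))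

theorem one_sub_inner_pos {P x : R3} (hP : ‖P‖ < 1) (hx : ‖x‖ ≤ 1) : 0 < 1 - inner ℝ x P := by
  nlinarith [real_inner_le_norm x P, norm_nonneg x, norm_nonneg P]

theorem coneWeight_of_one_le {P x : R3} (hx : 1 ≤ ‖x‖) : coneWeight P x = 0 := by
  have : 1 - ‖x‖ ^ 2 ≤ 0 := by nlinarith
  rw [coneWeight, max_eq_left this, zero_div]

theorem coneWeight_nonneg {P : R3} (hP : ‖P‖ < 1) (x : R3) : 0 ≤ coneWeight P x := by
  rcases le_total 1 ‖x‖ with hx | hx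
  · rw [coneWeight_of_one_le hx]
  · have := one_sub_inner_pos hP hx
    unfold coneWeight
    positivity

theorem coneWeight_le_one {P : R3} (hP : ‖P‖ < 1) (x : R3) : coneWeight P x ≤ 1 := by
  rcases le_total 1 ‖x‖ with hx | hx
  · rw [coneWeight_of_one_le hx]; exact zero_le_one
  · have hl := one_sub_inner_pos hP hx
    have hk : 0 ≤ 1 - ‖x‖ ^ 2 := by nlinarith [norm_nonneg x]
    unfold coneWeight
    rw [max_eq_right hk]
    refine div_le_one_of_le₀ ?_ (by positivity)
    suffices h : 1 - ‖x‖ ^ 2 - (1 - inner ℝ x P)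
        ≤ √((1 - inner ℝ x P) ^ 2 - (1 - ‖P‖ ^ 2) * (1 - ‖x‖ ^ 2)) by linarith
    refine Real.le_sqrt_of_sq_le ?_
    nlinarith [sq_nonneg ‖x - P‖, norm_sub_sq_real x P,
      mul_nonneg hk (sq_nonneg ‖x - P‖)]

theorem norm_sub_coneWeight_smul {P x : R3} (hP : ‖P‖ < 1) (hx : ‖x‖ ≤ 1) :
    ‖x - coneWeight P x • P‖ = 1 - coneWeight P x := by
  have hl := one_sub_inner_pos hP hx
  have hk : 0 ≤ 1 - ‖x‖ ^ 2 := by nlinarith [norm_nonneg x]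
  have hD : 0 ≤ (1 - inner ℝ x P) ^ 2 - (1 - ‖P‖ ^ 2) * (1 - ‖x‖ ^ 2) := by
    have h1 := real_inner_le_norm x P
    have h2 : 0 ≤ 1 - ‖x‖ * ‖P‖ := by nlinarith [norm_nonneg x, norm_nonneg P]
    nlinarith [sq_nonneg (‖x‖ - ‖P‖)]
  have hμ : (1 - ‖P‖ ^ 2) * coneWeight P x ^ 2 - 2 * (1 - inner ℝ x P) * coneWeight P x
      + (1 - ‖x‖ ^ 2) = 0 := by
    unfold coneWeight
    rw [max_eq_right hk]
    set s := √((1 - inner ℝ x P) ^ 2 - (1 - ‖P‖ ^ 2) * (1 - ‖x‖ ^ 2)) with hs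
    have hs2 : s ^ 2 = (1 - inner ℝ x P) ^ 2 - (1 - ‖P‖ ^ 2) * (1 - ‖x‖ ^ 2) := Real.sq_sqrt hD
    have hs0 : 0 ≤ s := Real.sqrt_nonneg _
    have hne : (1 - inner ℝ x P) + s ≠ 0 := by positivity
    field_simp
    linear_combination (1 - ‖x‖ ^ 2) * hs2
  have h1 := coneWeight_le_one hP x
  rw [← sq_eq_sq₀ (norm_nonneg _) (by linarith), norm_sub_sq_real, inner_smul_right, norm_smul,
    mul_pow, Real.norm_eq_abs, sq_abs]
  linear_combination -hμ

theorem coneWeight_unique {P x : R3} (hP : ‖P‖ < 1) {μ ν : ℝ} (hμ : ‖x - μ • P‖ = 1 - μ)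
    (hν : ‖x - ν • P‖ = 1 - ν) : μ = ν := by
  have h : |μ - ν| ≤ |μ - ν| * ‖P‖ := by
    have e : (x - ν • P) - (x - μ • P) = (μ - ν) • P := by rw [sub_smul]; abel
    have := abs_norm_sub_norm_le (x - ν • P) (x - μ • P)
    rw [e, hμ, hν, norm_smul, Real.norm_eq_abs] at this
    rwa [show (1 - ν - (1 - μ)) = μ - ν by ring] at this
  by_contra hne
  have := abs_pos.2 (sub_ne_zero.2 hne)
  nlinarith

theorem coneWeight_self {P : R3} (hP : ‖P‖ < 1) : coneWeight P P = 1 :=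
  coneWeight_unique hP (norm_sub_coneWeight_smul hP hP.le) (by simp)

/-- Moving the apex of the cone from `P` to `P + D` moves the point `x` of weight `μ` to
`x + μ D`, and keeps its weight. -/
theorem coneWeight_add_smul {P D x : R3} (hP : ‖P‖ < 1) (hPD : ‖P + D‖ < 1) :
    coneWeight (P + D) (x + coneWeight P x • D) = coneWeight P x ∧
      (‖x‖ ≤ 1 → ‖x + coneWeight P x • D‖ ≤ 1) := by
  rcases le_total ‖x‖ 1 with hx | hx
  · have e : x + coneWeight P x • D - coneWeight P x • (P + D) = x - coneWeight P x • P := by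
      rw [smul_add]; abel
    have h0 := coneWeight_nonneg hP x
    have hE : ‖x + coneWeight P x • D - coneWeight P x • (P + D)‖ = 1 - coneWeight P x := by
      rw [e, norm_sub_coneWeight_smul hP hx]
    have hy : ‖x + coneWeight P x • D‖ ≤ 1 := by
      have h := norm_add_le (x + coneWeight P x • D - coneWeight P x • (P + D))
        (coneWeight P x • (P + D))
      rw [sub_add_cancel, hE, norm_smul, Real.norm_of_nonneg h0] at h
      nlinarith
    exact ⟨coneWeight_unique hPD (norm_sub_coneWeight_smul hPD hy) hE, fun _ => hy⟩
  · have h : coneWeight P x = 0 := coneWeight_of_one_le hx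
    rw [h, zero_smul, add_zero]
    exact ⟨coneWeight_of_one_le hx, fun h => h⟩

theorem continuousAt_coneWeight {P x : R3} (hP : ‖P‖ < 1) :
    ContinuousAt (fun p : R3 × R3 => coneWeight p.1 p.2) (P, x) := by
  rcases le_or_gt ‖x‖ 1 with hx | hx
  · have hl := one_sub_inner_pos hP hx
    unfold coneWeight
    refine ContinuousAt.div (by fun_prop) (by fun_prop) ?_
    have := Real.sqrt_nonneg ((1 - inner ℝ x P) ^ 2 - (1 - ‖P‖ ^ 2) * (1 - ‖x‖ ^ 2))
    exact (by positivity : (0:ℝ) < (1 - inner ℝ x P)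
      + √((1 - inner ℝ x P) ^ 2 - (1 - ‖P‖ ^ 2) * (1 - ‖x‖ ^ 2))).ne'
  · have hev : ∀ᶠ p : R3 × R3 in 𝓝 (P, x), (0 : ℝ) = coneWeight p.1 p.2 := by
      have : ∀ᶠ p : R3 × R3 in 𝓝 (P, x), 1 < ‖p.2‖ :=
        continuousAt_snd.norm.eventually (lt_mem_nhds hx)
      filter_upwards [this] with p hp using (coneWeight_of_one_le hp.le).symm
    exact continuousAt_const.congr hev

/-! ### Isotopies of the ball that preserve parallel planes -/

/-- The displacement that, in each plane `⟨x, w⟩ = h`, moves the apex `P h` by `D h`. -/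
noncomputable def sliceShift (w : R3) (P D : ℝ → R3) (x : R3) : R3 :=
  coneWeight (P (inner ℝ x w)) x • D (inner ℝ x w)

/-- At a height where the arc is on the sphere, `coneWeight` need not be continuous, but there `D`
vanishes and bounds the displacement. -/
theorem continuous_sliceShift {w : R3} {P D : ℝ → R3} (hP : Continuous P) (hD : Continuous D)
    (h : ∀ t, D t = 0 ∨ ‖P t‖ < 1) : Continuous (sliceShift w P D) := by
  have hle : ∀ x, ‖sliceShift w P D x‖ ≤ ‖D (inner ℝ x w)‖ := fun x => by
    rw [sliceShift, norm_smul]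
    rcases h (inner ℝ x w) with h0 | h1
    · simp [h0]
    · rw [Real.norm_of_nonneg (coneWeight_nonneg h1 x)]
      exact mul_le_of_le_one_left (norm_nonneg _) (coneWeight_le_one h1 x)
  refine continuous_iff_continuousAt.2 fun x => ?_
  rcases h (inner ℝ x w) with h0 | h1
  · have hx : sliceShift w P D x = 0 := by simp [sliceShift, h0]
    rw [ContinuousAt, hx]
    refine squeeze_zero_norm hle ?_
    have hc : Continuous fun y : R3 => ‖D (inner ℝ y w)‖ := by fun_prop
    simpa [h0] using hc.tendsto x
  · have hc : Continuous fun y : R3 => (P (inner ℝ y w), y) := by fun_prop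
    have h2 : ContinuousAt (fun y : R3 => coneWeight (P (inner ℝ y w)) y) x :=
      ContinuousAt.comp (g := fun p : R3 × R3 => coneWeight p.1 p.2)
        (f := fun y : R3 => (P (inner ℝ y w), y)) (continuousAt_coneWeight h1) hc.continuousAt
    have h3 : Continuous fun y : R3 => D (inner ℝ y w) := by fun_prop
    exact h2.smul h3.continuousAt

theorem sliceShift_leftInverse {w : R3} {P D : ℝ → R3}
    (h : ∀ t, D t = 0 ∨ (‖P t‖ < 1 ∧ ‖P t + D t‖ < 1)) (hw : ∀ t, inner ℝ (D t) w = 0) (x : R3) :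
    x + sliceShift w P D x + sliceShift w (fun t => P t + D t) (fun t => -D t)
      (x + sliceShift w P D x) = x := by
  have hh : inner ℝ (x + sliceShift w P D x) w = inner ℝ x w := by
    rw [inner_add_left, sliceShift, inner_smul_left, hw]; simp
  conv_lhs => rw [sliceShift.eq_1 w (fun t => P t + D t), hh]
  rcases h (inner ℝ x w) with h0 | ⟨h1, h2⟩
  · simp [h0, sliceShift]
  · have := (coneWeight_add_smul (x := x) h1 h2).1
    rw [sliceShift, this]
    simp

/-- Two arcs in the unit ball that meet each plane `⟨x, w⟩ = h` at most once, at `P h` and at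
`Q h`, and that have the same end points on the sphere, are isotopic in the ball. -/
theorem exists_ambientIsotopy_slices {w : R3} {P Q : ℝ → R3} (hP : Continuous P)
    (hQ : Continuous Q) (h : ∀ t, P t = Q t ∨ (‖P t‖ < 1 ∧ ‖Q t‖ < 1))
    (hw : ∀ t, inner ℝ (P t) w = inner ℝ (Q t) w) :
    ∃ Φ : AmbientIsotopy, Φ.H 1 '' Metric.closedBall 0 1 = Metric.closedBall 0 1 ∧
      ∀ t, inner ℝ (P t) w = t → Φ.H 1 (P t) = Q t := by
  set D : ℝ → ℝ → R3 := fun c t => c • (Q t - P t) with hD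
  have hDcont : ∀ c, Continuous (D c) := fun c => by fun_prop
  have hPDcont : ∀ c, Continuous fun t => P t + D c t := fun c => by fun_prop
  have hnDcont : ∀ c, Continuous fun t => - D c t := fun c => by fun_prop
  have hcase : ∀ c ∈ Icc (0:ℝ) 1, ∀ t, D c t = 0 ∨ (‖P t‖ < 1 ∧ ‖P t + D c t‖ < 1) := by
    intro c hc t
    rcases h t with h0 | ⟨h1, h2⟩
    · left; simp [hD, h0]
    · right
      refine ⟨h1, ?_⟩
      have e : P t + D c t = (1 - c) • P t + c • Q t := by
        simp only [hD, smul_sub, sub_smul, one_smul]; abel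
      have hb := convex_ball (0 : R3) 1 (mem_ball_zero_iff.2 h1) (mem_ball_zero_iff.2 h2)
        (sub_nonneg.2 hc.2) hc.1 (by ring)
      rw [e]
      exact mem_ball_zero_iff.1 hb
  have hcase' : ∀ c ∈ Icc (0:ℝ) 1, ∀ t,
      -D c t = 0 ∨ (‖P t + D c t‖ < 1 ∧ ‖P t + D c t + -D c t‖ < 1) := by
    intro c hc t
    rcases hcase c hc t with h0 | ⟨h1, h2⟩
    · left; simp [h0]
    · right; exact ⟨h2, by simpa using h1⟩
  have hDw : ∀ c t, inner ℝ (D c t) w = 0 := fun c t => by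
    simp only [hD, inner_smul_left, inner_sub_left, hw t, sub_self, mul_zero]
  have hinv : ∀ c ∈ Icc (0:ℝ) 1, ∀ x,
      x + sliceShift w (fun t => P t + D c t) (fun t => -D c t) x +
        sliceShift w P (D c)
          (x + sliceShift w (fun t => P t + D c t) (fun t => -D c t) x) = x := by
    intro c hc x
    have := sliceShift_leftInverse (hcase' c hc) (w := w)
      (fun t => by rw [inner_neg_left, hDw, neg_zero]) x
    simpa using this
  have hball : ∀ c ∈ Icc (0:ℝ) 1, ∀ x, ‖x‖ ≤ 1 → ‖x + sliceShift w P (D c) x‖ ≤ 1 := by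
    intro c hc x hx
    rcases hcase c hc (inner ℝ x w) with h0 | ⟨h1, h2⟩
    · simpa [sliceShift, h0] using hx
    · exact (coneWeight_add_smul h1 h2).2 hx
  have hball' : ∀ c ∈ Icc (0:ℝ) 1, ∀ x, ‖x‖ ≤ 1 →
      ‖x + sliceShift w (fun t => P t + D c t) (fun t => -D c t) x‖ ≤ 1 := by
    intro c hc x hx
    rcases hcase' c hc (inner ℝ x w) with h0 | ⟨h1, h2⟩
    · simpa [sliceShift, neg_eq_zero.1 h0] using hx
    · exact (coneWeight_add_smul h1 h2).2 hx
  let Ψ : unitInterval → (R3 ≃ₜ R3) := fun c =>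
    { toFun := fun x => x + sliceShift w P (D c) x
      invFun := fun x => x + sliceShift w (fun t => P t + D c t) (fun t => -D c t) x
      left_inv := sliceShift_leftInverse (hcase c c.2) (hDw c)
      right_inv := hinv c c.2
      continuous_toFun := continuous_id.add (continuous_sliceShift hP (hDcont c)
        fun t => (hcase c c.2 t).imp_right And.left)
      continuous_invFun := continuous_id.add (continuous_sliceShift (hPDcont c) (hnDcont c)
        fun t => (hcase' c c.2 t).imp_right And.left) }
  refine ⟨⟨Ψ, ?_, ?_⟩, ?_, fun t ht => ?_⟩
  · have e : (fun p : unitInterval × R3 => Ψ p.1 p.2)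
        = fun p => p.2 + (p.1 : ℝ) • sliceShift w P (D 1) p.2 := by
      ext1 p
      change p.2 + sliceShift w P (D p.1) p.2 = _
      simp only [sliceShift, hD, one_smul, smul_comm (p.1 : ℝ)]
    have hc : Continuous (sliceShift w P (D 1)) := continuous_sliceShift hP (hDcont 1)
        fun t => (hcase 1 (by simp) t).imp_right And.left
    rw [e]
    fun_prop
  · ext1 x
    change x + sliceShift w P (D ((0 : unitInterval) : ℝ)) x = x
    simp [sliceShift, hD]
  · refine Subset.antisymm ?_ fun y hy => ?_
    · rintro _ ⟨x, hx, rfl⟩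
      exact mem_closedBall_zero_iff.2
        (hball ((1 : unitInterval) : ℝ) (1 : unitInterval).2 x (mem_closedBall_zero_iff.1 hx))
    · refine ⟨(Ψ 1).symm y, ?_, (Ψ 1).apply_symm_apply y⟩
      exact mem_closedBall_zero_iff.2
        (hball' ((1 : unitInterval) : ℝ) (1 : unitInterval).2 y (mem_closedBall_zero_iff.1 hy))
  · change P t + sliceShift w P (D ((1 : unitInterval) : ℝ)) (P t) = Q t
    rw [sliceShift, ht]
    rcases h t with h0 | ⟨h1, -⟩
    · simp [hD, h0]
    · rw [coneWeight_self h1]; simp [hD]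

/-! ### Straightening a bent diameter -/

/-- The piecewise linear map that shears the two half spaces `⟨x, e⟩ ≥ 0` and `⟨x, e⟩ ≤ 0` in
the same direction. -/
noncomputable def halfShear (e v x : R3) : R3 := x + |inner ℝ x e| • v

/-- The norm-preserving version of `halfShear`: it has the same effect on the rays from the origin,
and preserves all spheres about the origin. -/
noncomputable def sphericalBend (e v x : R3) : R3 :=
  (‖x‖ / ‖halfShear e v x‖) • halfShear e v x

theorem halfShear_smul_halfShear {e v : R3} (hev : inner ℝ v e = 0) {c : ℝ} (hc : 0 ≤ c)
    (x : R3) : halfShear e (-v) (c • halfShear e v x) = c • x := by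
  have h : inner ℝ (halfShear e v x) e = inner ℝ x e := by
    rw [halfShear, inner_add_left, inner_smul_left, hev]; simp
  rw [halfShear, inner_smul_left, h, abs_mul]
  simp only [conj_trivial, abs_of_nonneg hc, halfShear, smul_add, smul_neg, smul_smul]
  abel

theorem halfShear_ne_zero {e v : R3} (hev : inner ℝ v e = 0) {x : R3} (hx : x ≠ 0) :
    halfShear e v x ≠ 0 := fun h => by
  have := halfShear_smul_halfShear hev zero_le_one x
  rw [h] at this
  simp [halfShear] at this
  exact hx this.symm

theorem norm_sphericalBend {e v : R3} (hev : inner ℝ v e = 0) (x : R3) :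
    ‖sphericalBend e v x‖ = ‖x‖ := by
  rcases eq_or_ne x 0 with rfl | hx
  · simp [sphericalBend]
  · have := norm_ne_zero_iff.2 (halfShear_ne_zero hev hx)
    rw [sphericalBend, norm_smul, norm_div, norm_norm, norm_norm, div_mul_cancel₀ _ this]

theorem sphericalBend_neg_leftInverse {e v : R3} (hev : inner ℝ v e = 0) :
    Function.LeftInverse (sphericalBend e (-v)) (sphericalBend e v) := fun x => by
  rcases eq_or_ne x 0 with rfl | hx
  · simp [sphericalBend]
  · have h0 := norm_pos_iff.2 (halfShear_ne_zero hev hx)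
    have hx0 := norm_pos_iff.2 hx
    rw [sphericalBend, norm_sphericalBend hev, sphericalBend,
      halfShear_smul_halfShear hev (by positivity), norm_smul, smul_smul, Real.norm_of_nonneg
        (by positivity)]
    have : ‖x‖ / (‖x‖ / ‖halfShear e v x‖ * ‖x‖) * (‖x‖ / ‖halfShear e v x‖) = 1 := by
      field_simp
    rw [this, one_smul]

theorem exists_ambientIsotopy_sphericalBend {e v : R3} (hev : inner ℝ v e = 0) :
    ∃ Φ : AmbientIsotopy, Φ.H 1 '' Metric.closedBall 0 1 = Metric.closedBall 0 1 ∧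
      ∀ x, Φ.H 1 x = sphericalBend e v x := by
  have hevt : ∀ t : ℝ, inner ℝ (t • v) e = 0 := fun t => by rw [inner_smul_left, hev, mul_zero]
  have hcont : Continuous fun p : ℝ × R3 => sphericalBend e (p.1 • v) p.2 := by
    refine continuous_iff_continuousAt.2 fun ⟨t, x⟩ => ?_
    rcases eq_or_ne x 0 with rfl | hx
    · have h0 : sphericalBend e (t • v) 0 = 0 := by simp [sphericalBend]
      rw [ContinuousAt, h0]
      refine squeeze_zero_norm (a := fun p : ℝ × R3 => ‖p.2‖)
        (fun p => (norm_sphericalBend (hevt p.1) p.2).le) ?_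
      have hc : Continuous fun p : ℝ × R3 => ‖p.2‖ := by fun_prop
      simpa using hc.tendsto (t, (0 : R3))
    · have hL : Continuous fun p : ℝ × R3 => halfShear e (p.1 • v) p.2 := by
        unfold halfShear; fun_prop
      have hx' : ‖halfShear e (t • v) x‖ ≠ 0 := norm_ne_zero_iff.2 (halfShear_ne_zero (hevt t) hx)
      have hn : Continuous fun p : ℝ × R3 => ‖p.2‖ := by fun_prop
      have hd : ContinuousAt (fun p : ℝ × R3 => ‖p.2‖ / ‖halfShear e (p.1 • v) p.2‖) (t, x) :=
        hn.continuousAt.div hL.norm.continuousAt hx'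
      unfold sphericalBend
      exact hd.smul hL.continuousAt
  have hc1 : ∀ t : ℝ, Continuous (sphericalBend e (t • v)) := fun t =>
    Continuous.comp (g := fun p : ℝ × R3 => sphericalBend e (p.1 • v) p.2)
      (f := fun x : R3 => (t, x)) hcont (by fun_prop)
  have hneg : ∀ t : ℝ, sphericalBend e (-(t • v)) = sphericalBend e ((-t) • v) := fun t => by
    rw [neg_smul]
  let Ψ : unitInterval → (R3 ≃ₜ R3) := fun t =>
    { toFun := sphericalBend e ((t : ℝ) • v)
      invFun := sphericalBend e (-((t : ℝ) • v))
      left_inv := sphericalBend_neg_leftInverse (hevt t)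
      right_inv := by
        have := sphericalBend_neg_leftInverse (e := e) (v := -((t : ℝ) • v))
          (by rw [inner_neg_left, hevt, neg_zero])
        rwa [neg_neg] at this
      continuous_toFun := hc1 t
      continuous_invFun := by rw [hneg]; exact hc1 _ }
  refine ⟨⟨Ψ, ?_, ?_⟩, ?_, fun x => ?_⟩
  · change Continuous fun p : unitInterval × R3 => sphericalBend e ((p.1 : ℝ) • v) p.2
    exact Continuous.comp (g := fun p : ℝ × R3 => sphericalBend e (p.1 • v) p.2)
      (f := fun p : unitInterval × R3 => ((p.1 : ℝ), p.2)) hcont (by fun_prop)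
  · ext1 x
    change sphericalBend e (((0 : unitInterval) : ℝ) • v) x = x
    rcases eq_or_ne x 0 with rfl | hx
    · simp [sphericalBend]
    · simp [sphericalBend, halfShear, div_self (norm_ne_zero_iff.2 hx)]
  · have hn : ∀ x, ‖Ψ 1 x‖ = ‖x‖ := norm_sphericalBend (hevt _)
    ext y
    simp only [mem_image, mem_closedBall_zero_iff]
    refine ⟨?_, fun hy => ⟨(Ψ 1).symm y, ?_, (Ψ 1).apply_symm_apply y⟩⟩
    · rintro ⟨x, hx, rfl⟩
      rwa [hn]
    · rwa [← hn, (Ψ 1).apply_symm_apply]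
  · change sphericalBend e (((1 : unitInterval) : ℝ) • v) x = sphericalBend e v x
    simp

/-! ### Arcs that are monotone in some direction are unknotted -/

/-- A chord of the unit ball is a trivial arc: slide it, in the planes orthogonal to it, to the
broken line through the centre with the same end points, and straighten this. -/
theorem isTrivialBallArc_segment {α β : R3} (hα : ‖α‖ = 1) (hβ : ‖β‖ = 1) (hne : α ≠ β) :
    IsTrivialBallArc (Metric.closedBall 0 1) (segment ℝ α β) := by
  set m : R3 := (2⁻¹ : ℝ) • (α + β) with hm
  set n : R3 := (2⁻¹ : ℝ) • (β - α) with hn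
  have hmn : inner ℝ m n = 0 := by
    rw [hm, hn, inner_smul_left, inner_smul_right, inner_add_left, inner_sub_right,
      inner_sub_right, real_inner_self_eq_norm_sq, real_inner_self_eq_norm_sq, hα, hβ,
      real_inner_comm]
    simp
  have hn0 : n ≠ 0 := smul_ne_zero (by norm_num) (sub_ne_zero.2 hne.symm)
  have hnpos : 0 < ‖n‖ := norm_pos_iff.2 hn0
  have hmβ : m + n = β := by rw [hm, hn]; module
  have hmα : m - n = α := by rw [hm, hn]; module
  clear_value m n
  have hpy : ∀ a b : ℝ, ‖a • m + b • n‖ ^ 2 = a ^ 2 * ‖m‖ ^ 2 + b ^ 2 * ‖n‖ ^ 2 := fun a b => by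
    rw [norm_add_sq_real, inner_smul_left, inner_smul_right, hmn, norm_smul, norm_smul, mul_pow,
      mul_pow, Real.norm_eq_abs, Real.norm_eq_abs, sq_abs, sq_abs]
    ring
  have hsum : ‖m‖ ^ 2 + ‖n‖ ^ 2 = 1 := by
    have := hpy 1 1
    rw [one_smul, one_smul, hmβ, hβ] at this
    linarith
  have hin : ∀ a b : ℝ, inner ℝ (a • m + b • n) n = b * ‖n‖ ^ 2 := fun a b => by
    rw [inner_add_left, inner_smul_left, inner_smul_left, hmn, real_inner_self_eq_norm_sq]
    simp
  have hseg : segment ℝ α β = (fun σ : ℝ => (1 : ℝ) • m + σ • n) '' Icc (-1) 1 := by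
    rw [segment_eq_image']
    ext y
    constructor
    · rintro ⟨θ, hθ, rfl⟩
      refine ⟨2 * θ - 1, ⟨by linarith [hθ.1], by linarith [hθ.2]⟩, ?_⟩
      simp only [← hmα, ← hmβ]
      module
    · rintro ⟨σ, hσ, rfl⟩
      refine ⟨(σ + 1) / 2, ⟨by linarith [hσ.1], by linarith [hσ.2]⟩, ?_⟩
      simp only [← hmα, ← hmβ]
      module
  -- The chord and the broken line, as functions of the height `t = ⟨x, n⟩`.
  set σ : ℝ → ℝ := fun t => max (-1) (min 1 (t / ‖n‖ ^ 2)) with hσ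
  have hσc : Continuous σ := by fun_prop
  have hσI : ∀ t, |σ t| ≤ 1 := fun t =>
    abs_le.2 ⟨le_max_left _ _, max_le (by norm_num) (min_le_left _ _)⟩
  have hσeq : ∀ s ∈ Icc (-1 : ℝ) 1, σ (s * ‖n‖ ^ 2) = s := fun s hs => by
    simp only [hσ]
    rw [mul_div_cancel_right₀ _ (by positivity), min_eq_right hs.2, max_eq_right hs.1]
  obtain ⟨Φ, hΦB, hΦ⟩ := exists_ambientIsotopy_slices (w := n)
    (P := fun t => (1 : ℝ) • m + σ t • n) (Q := fun t => |σ t| • m + σ t • n)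
    (by fun_prop) (by fun_prop) (fun t => by
      rcases (hσI t).eq_or_lt with h1 | h1
      · left; simp only [h1]
      · right
        have h2 : σ t ^ 2 < 1 := by rw [← sq_abs]; nlinarith [abs_nonneg (σ t)]
        constructor
        · rw [← sq_lt_one_iff₀ (norm_nonneg _), hpy]
          nlinarith [sq_pos_of_pos hnpos]
        · rw [← sq_lt_one_iff₀ (norm_nonneg _), hpy, sq_abs]
          nlinarith)
    (fun t => by simp only [hin])
  obtain ⟨Ψ, hΨB, hΨ⟩ := exists_ambientIsotopy_sphericalBend (e := n) (v := -(‖n‖ ^ 2)⁻¹ • m)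
    (by rw [inner_smul_left, hmn, mul_zero])
  refine ⟨0, 1, ‖n‖⁻¹ • n, one_pos, by rw [norm_smul, norm_inv, norm_norm,
    inv_mul_cancel₀ hnpos.ne'], ?_⟩
  refine PairAmbientIsotopic.trans ⟨Φ, hΦB, rfl⟩ ⟨Ψ, hΨB, ?_⟩
  have hbend : ∀ s ∈ Icc (-1 : ℝ) 1,
      Ψ.H 1 (Φ.H 1 ((1 : ℝ) • m + s • n)) = s • ‖n‖⁻¹ • n := fun s hs => by
    have h1 := hΦ (s * ‖n‖ ^ 2) (by rw [hin, hσeq s hs])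
    simp only [hσeq s hs] at h1
    rw [h1, hΨ]
    have hL : halfShear n (-(‖n‖ ^ 2)⁻¹ • m) (|s| • m + s • n) = s • n := by
      rw [halfShear, hin, abs_mul, abs_of_nonneg (sq_nonneg ‖n‖), smul_smul]
      have : |s| * ‖n‖ ^ 2 * -(‖n‖ ^ 2)⁻¹ = -|s| := by field_simp
      rw [this, neg_smul]
      abel
    have hN : ‖|s| • m + s • n‖ = |s| := by
      rw [← sq_eq_sq₀ (norm_nonneg _) (abs_nonneg _), hpy, sq_abs, ← mul_add, hsum, mul_one]
    rw [sphericalBend, hL, hN, norm_smul, Real.norm_eq_abs, smul_smul, smul_smul]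
    rcases eq_or_ne s 0 with rfl | hs0
    · simp
    · have := abs_pos.2 hs0
      congr 1
      field_simp
  rw [hseg, image_image, image_image, segment_eq_image']
  ext y
  constructor
  · rintro ⟨s, hs, rfl⟩
    refine ⟨(s + 1) / 2, ⟨by linarith [hs.1], by linarith [hs.2]⟩, ?_⟩
    simp only [hbend s hs]
    module
  · rintro ⟨θ, hθ, rfl⟩
    have h1 : 2 * θ - 1 ∈ Icc (-1 : ℝ) 1 := ⟨by linarith [hθ.1], by linarith [hθ.2]⟩
    refine ⟨2 * θ - 1, h1, ?_⟩
    simp only [hbend _ h1]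
    module

/-- An arc in the unit ball along which some linear functional increases is isotopic to a chord. -/
theorem isTrivialBallArc_unitBall_of_strictMonoOn {f : ℝ → R3} {a b : ℝ} {w : R3} (hab : a < b)
    (hf : ContinuousOn f (Icc a b)) (hw : StrictMonoOn (fun s => inner ℝ (f s) w) (Icc a b))
    (ha : ‖f a‖ = 1) (hb : ‖f b‖ = 1) (hI : ∀ s ∈ Ioo a b, ‖f s‖ < 1) :
    IsTrivialBallArc (Metric.closedBall 0 1) (f '' Icc a b) := by
  have haI : a ∈ Icc a b := left_mem_Icc.2 hab.le
  have hbI : b ∈ Icc a b := right_mem_Icc.2 hab.le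
  set φ : ℝ → ℝ := fun s => inner ℝ (f s) w with hφ
  have hφab : φ a < φ b := hw haI hbI hab
  have hne : f a ≠ f b := fun h => hφab.ne (by simp only [hφ, h])
  set cl : ℝ → ℝ := fun s => max a (min b s) with hcl
  have hclc : Continuous cl := by fun_prop
  have hclI : ∀ s, cl s ∈ Icc a b := fun s =>
    ⟨le_max_left _ _, max_le hab.le (min_le_left _ _)⟩
  have hcl_eq : ∀ s ∈ Icc a b, cl s = s := fun s hs => by
    simp only [hcl]; rw [min_eq_right hs.2, max_eq_right hs.1]
  have hfcl : Continuous fun s => f (cl s) := hf.comp_continuous hclc hclI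
  have hφcl : Continuous fun s => φ (cl s) := hfcl.inner continuous_const
  -- Extend the height to an increasing bijection of the line, with inverse `τ`.
  set g : ℝ → ℝ := fun s => φ (cl s) + (s - cl s) with hg
  have hgc : Continuous g := hφcl.add (continuous_id.sub hclc)
  have hclmono : Monotone cl := fun s t hst => max_le_max le_rfl (min_le_min le_rfl hst)
  have hgmono : StrictMono g := by
    intro s t hst
    have h1 : φ (cl s) ≤ φ (cl t) := hw.monotoneOn (hclI s) (hclI t) (hclmono hst.le)
    have h2 : s - cl s ≤ t - cl t := by
      simp only [hcl]
      rcases max_cases a (min b s) with h | h <;> rcases max_cases a (min b t) with h' | h' <;>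
        rcases min_cases b s with h'' | h'' <;> rcases min_cases b t with h3 | h3 <;> linarith
    rcases (hclmono hst.le).eq_or_lt with h | h
    · simp only [hg, h]; linarith
    · have := hw (hclI s) (hclI t) h
      simp only [hg]; linarith
  have hgt : Tendsto g atTop atTop := by
    refine tendsto_atTop_mono' _ ?_ (tendsto_atTop_add_const_right atTop (φ b - b) tendsto_id)
    filter_upwards [eventually_ge_atTop b] with s hs
    have : cl s = b := by simp only [hcl]; rw [min_eq_left hs, max_eq_right hab.le]
    simp only [hg, this, id]; linarith
  have hgb : Tendsto g atBot atBot := by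
    refine tendsto_atBot_mono' _ ?_ (tendsto_atBot_add_const_right atBot (φ a - a) tendsto_id)
    filter_upwards [eventually_le_atBot a] with s hs
    have : cl s = a := by simp only [hcl]; rw [min_eq_right (hs.trans hab.le), max_eq_left hs]
    simp only [hg, this, id]; linarith
  set τ := (hgmono.orderIsoOfSurjective g (hgc.surjective hgt hgb)).symm with hτ
  have hτc : Continuous τ := τ.continuous
  have hτg : ∀ s, τ (g s) = s := fun s =>
    (hgmono.orderIsoOfSurjective g (hgc.surjective hgt hgb)).symm_apply_apply s
  set lam : ℝ → ℝ := fun t => (φ (cl (τ t)) - φ a) / (φ b - φ a) with hlam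
  have hlamc : Continuous lam := ((hφcl.comp hτc).sub continuous_const).div_const _
  have hφd : φ b - φ a ≠ 0 := (sub_pos.2 hφab).ne'
  obtain ⟨Φ, hΦB, hΦ⟩ := exists_ambientIsotopy_slices (w := w) (P := fun t => f (cl (τ t)))
    (Q := fun t => f a + lam t • (f b - f a)) (hfcl.comp hτc) (by fun_prop)
    (fun t => by
      rcases le_or_gt (τ t) a with h1 | h1
      · left
        have : cl (τ t) = a := by
          simp only [hcl]; rw [min_eq_right (h1.trans hab.le), max_eq_left h1]
        simp only [hlam, this, sub_self, zero_div, zero_smul, add_zero]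
      rcases le_or_gt b (τ t) with h2 | h2
      · left
        have : cl (τ t) = b := by simp only [hcl]; rw [min_eq_left h2, max_eq_right hab.le]
        simp only [hlam, this, div_self hφd, one_smul, add_sub_cancel]
      right
      have h3 : cl (τ t) = τ t := hcl_eq _ ⟨h1.le, h2.le⟩
      simp only [hlam, h3]
      refine ⟨hI _ ⟨h1, h2⟩, ?_⟩
      have h4 := hw haI ⟨h1.le, h2.le⟩ h1
      have h5 := hw ⟨h1.le, h2.le⟩ hbI h2
      have h6 : 0 < φ b - φ a := sub_pos.2 hφab
      have h7 : 0 < (φ (τ t) - φ a) / (φ b - φ a) := div_pos (sub_pos.2 h4) h6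
      have h8 : (φ (τ t) - φ a) / (φ b - φ a) < 1 := by
        rw [div_lt_one h6]; linarith [show φ (τ t) < φ b from h5]
      have h9 := norm_combo_lt_of_ne ha.le hb.le hne (sub_pos.2 h8) h7 (by ring)
      have e : f a + ((φ (τ t) - φ a) / (φ b - φ a)) • (f b - f a)
          = (1 - (φ (τ t) - φ a) / (φ b - φ a)) • f a
            + ((φ (τ t) - φ a) / (φ b - φ a)) • f b := by module
      rw [e]
      exact h9)
    (fun t => by
      simp only [inner_add_left, inner_smul_left, inner_sub_left, conj_trivial]
      change φ (cl (τ t)) = φ a + lam t * (φ b - φ a)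
      simp only [hlam]
      rw [div_mul_cancel₀ _ hφd]; ring)
  obtain ⟨x, r, u, hr, hu, hpair⟩ := isTrivialBallArc_segment ha hb hne
  refine ⟨x, r, u, hr, hu, PairAmbientIsotopic.trans ⟨Φ, hΦB, ?_⟩ hpair⟩
  have key : ∀ s ∈ Icc a b, Φ.H 1 (f s) = f a + ((φ s - φ a) / (φ b - φ a)) • (f b - f a) := by
    intro s hs
    have hgs : g s = φ s := by simp only [hg, hcl_eq s hs]; ring
    have hts : cl (τ (φ s)) = s := by rw [← hgs, hτg, hcl_eq s hs]
    have := hΦ (φ s) (by rw [hts])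
    simpa only [hlam, hts] using this
  rw [segment_eq_image', image_image]
  have h6 : 0 < φ b - φ a := sub_pos.2 hφab
  ext y
  constructor
  · rintro ⟨s, hs, rfl⟩
    refine ⟨(φ s - φ a) / (φ b - φ a), ⟨?_, ?_⟩, (key s hs).symm⟩
    · exact div_nonneg (sub_nonneg.2 (hw.monotoneOn haI hs hs.1)) h6.le
    · rw [div_le_one h6]
      have : φ s ≤ φ b := hw.monotoneOn hs hbI hs.2
      linarith
  · rintro ⟨θ, hθ, rfl⟩
    have hφc : ContinuousOn φ (Icc a b) := hf.inner continuousOn_const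
    obtain ⟨s, hs, hsθ⟩ := intermediate_value_Icc hab.le hφc
      (show φ a + θ * (φ b - φ a) ∈ Icc (φ a) (φ b) from
        ⟨by nlinarith [hθ.1], by nlinarith [hθ.2]⟩)
    refine ⟨s, hs, ?_⟩
    change Φ.H 1 (f s) = f a + θ • (f b - f a)
    rw [key s hs, hsθ, add_sub_cancel_left, mul_div_cancel_right₀ _ hφd]

/-- An arc properly embedded in a round ball along which some linear functional increases is
unknotted. -/
theorem isTrivialBallArc_of_strictMonoOn {f : ℝ → R3} {a b r : ℝ} {x w : R3} (hr : 0 < r)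
    (hab : a < b) (hf : ContinuousOn f (Icc a b))
    (hw : ∀ s ∈ Icc a b, ∀ t ∈ Icc a b, s < t → 0 < inner ℝ (f t - f s) w)
    (ha : f a ∈ Metric.sphere x r) (hb : f b ∈ Metric.sphere x r)
    (hI : f '' Ioo a b ⊆ Metric.ball x r) :
    IsTrivialBallArc (Metric.closedBall x r) (f '' Icc a b) := by
  obtain ⟨Φ, hΦ⟩ := exists_ambientIsotopy_affine (inv_pos.2 hr) (-(r⁻¹ • x))
  have hΦ' : ∀ y, Φ.H 1 y = r⁻¹ • (y - x) := fun y => by rw [hΦ, smul_sub]; abel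
  have hnorm : ∀ y, ‖Φ.H 1 y‖ = r⁻¹ * dist y x := fun y => by
    rw [hΦ', norm_smul, Real.norm_of_nonneg (inv_pos.2 hr).le, dist_eq_norm]
  have hball : Φ.H 1 '' Metric.closedBall x r = Metric.closedBall 0 1 := by
    ext y
    constructor
    · rintro ⟨z, hz, rfl⟩
      rw [mem_closedBall_zero_iff, hnorm, inv_mul_le_iff₀ hr, mul_one]
      exact hz
    · intro hy
      refine ⟨(Φ.H 1).symm y, ?_, (Φ.H 1).apply_symm_apply y⟩
      rw [mem_closedBall_zero_iff, ← (Φ.H 1).apply_symm_apply y, hnorm, inv_mul_le_iff₀ hr,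
        mul_one] at hy
      exact hy
  obtain ⟨x', r', u, hr', hu, hpair⟩ := isTrivialBallArc_unitBall_of_strictMonoOn
    (f := fun s => Φ.H 1 (f s)) (w := w) hab ((Φ.H 1).continuous.comp_continuousOn hf)
    (fun s hs t ht hst => by
      have h := hw s hs t ht hst
      rw [inner_sub_left] at h
      have : 0 < r⁻¹ := inv_pos.2 hr
      simp only [hΦ', inner_smul_left, inner_sub_left, conj_trivial]
      exact mul_lt_mul_of_pos_left (by linarith) this)
    (by rw [hnorm, Metric.mem_sphere.1 ha, inv_mul_cancel₀ hr.ne'])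
    (by rw [hnorm, Metric.mem_sphere.1 hb, inv_mul_cancel₀ hr.ne'])
    (fun s hs => by
      rw [hnorm, inv_mul_lt_iff₀ hr, mul_one]
      exact hI (mem_image_of_mem f hs))
  exact ⟨x', r', u, hr', hu, PairAmbientIsotopic.trans ⟨Φ, hball, by rw [image_image]⟩ hpair⟩

/-! ### Periodic curves with unit speed -/

theorem periodic_one_sub_int {E : Type*} {f : ℝ → E} (hf : Function.Periodic f 1) (n : ℤ) (x : ℝ) :
    f (x - n) = f x := by
  simpa using hf.sub_zsmul_eq n (x := x)

theorem periodic_one_fract {f : ℝ → R3} (hf : Function.Periodic f 1) (x : ℝ) :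
    f (Int.fract x) = f x := periodic_one_sub_int hf ⌊x⌋ x

theorem periodic_one_image_Ico {f : ℝ → R3} (hf : Function.Periodic f 1) :
    f '' Ico 0 1 = range f := by
  refine (image_subset_range _ _).antisymm ?_
  rintro _ ⟨x, rfl⟩
  exact ⟨Int.fract x, ⟨Int.fract_nonneg x, Int.fract_lt_one x⟩, periodic_one_fract hf x⟩

/-- A curve whose velocity stays `ε`-close to `u` on an interval is `ε`-close there to a line in
direction `u`. -/
theorem norm_sub_sub_smul_le {f g : ℝ → R3} {a b ε : ℝ} {u : R3}
    (hfg : ∀ s ∈ Icc a b, HasDerivWithinAt f (g s) (Icc a b) s)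
    (hu : ∀ s ∈ Icc a b, ‖g s - u‖ ≤ ε) {s t : ℝ} (hs : s ∈ Icc a b) (ht : t ∈ Icc a b)
    (hst : s ≤ t) : ‖f t - f s - (t - s) • u‖ ≤ ε * (t - s) := by
  have h : ∀ x ∈ Icc a b, HasDerivWithinAt (fun x => f x - x • u) (g x - u) (Icc a b) x := by
    intro x hx
    have h1 := (hasDerivWithinAt_id x (Icc a b)).smul_const u
    rw [one_smul] at h1
    exact (hfg x hx).sub h1
  have := (convex_Icc a b).norm_image_sub_le_of_norm_hasDerivWithin_le h hu hs ht
  rw [Real.norm_of_nonneg (sub_nonneg.2 hst)] at this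
  have e : f t - f s - (t - s) • u = f t - t • u - (f s - s • u) := by module
  rw [e]
  exact this

/-- A simple `C¹` curve of unit speed on `[0,1]` has image of length at least `1`.  Cut `[0,1]`
into short intervals; on each, the curve projects onto a long interval of its initial tangent. -/
theorem one_le_hausdorffMeasure_image {f g : ℝ → R3}
    (hfg : ∀ s ∈ Icc (0 : ℝ) 1, HasDerivWithinAt f (g s) (Icc 0 1) s)
    (hg : ContinuousOn g (Icc 0 1)) (hg1 : ∀ s ∈ Icc (0 : ℝ) 1, ‖g s‖ = 1)
    (hinj : InjOn f (Ico 0 1)) : 1 ≤ Measure.hausdorffMeasure 1 (f '' Ico 0 1) := by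
  have hf : ContinuousOn f (Icc 0 1) := fun s hs => (hfg s hs).continuousWithinAt
  suffices h : ∀ ε : ℝ, 0 < ε →
      ENNReal.ofReal (1 - ε) ≤ Measure.hausdorffMeasure 1 (f '' Ico 0 1) by
    have hlim : Tendsto (fun ε : ℝ => ENNReal.ofReal (1 - ε)) (𝓝[>] 0) (𝓝 1) := by
      have hc : Continuous fun ε : ℝ => ENNReal.ofReal (1 - ε) :=
        ENNReal.continuous_ofReal.comp (by fun_prop)
      simpa using (hc.tendsto 0).mono_left nhdsWithin_le_nhds
    refine le_of_tendsto hlim ?_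
    filter_upwards [self_mem_nhdsWithin] with ε hε using h ε hε
  intro ε hε
  have huc := isCompact_Icc.uniformContinuousOn_of_continuous hg
  obtain ⟨δ, hδ, hδg⟩ := Metric.uniformContinuousOn_iff.1 huc ε hε
  obtain ⟨n, hn⟩ := exists_nat_one_div_lt hδ
  set N : ℝ := (n : ℝ) + 1 with hN
  have hNpos : 0 < N := by positivity
  -- The images of the intervals `[k/N, (k+1)/N)` are disjoint, each of length `≥ (1-ε)/N`.
  have hpiece : ∀ k : ℕ, ((k : ℝ) + 1) / N ≤ 1 → ENNReal.ofReal ((1 - ε) / N) ≤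
      Measure.hausdorffMeasure 1 (f '' Ico (k / N) ((k + 1) / N)) := by
    intro k hk
    set p : ℝ := k / N with hp
    set q : ℝ := ((k : ℝ) + 1) / N with hq
    have hp0 : 0 ≤ p := by positivity
    have hqp : q - p = 1 / N := by rw [hp, hq]; ring
    have hpq : p ≤ q := by
      have : 0 < 1 / N := by positivity
      linarith
    have hsub : Icc p q ⊆ Icc 0 1 := Icc_subset_Icc hp0 hk
    have hpm : p ∈ Icc p q := left_mem_Icc.2 hpq
    have hqm : q ∈ Icc p q := right_mem_Icc.2 hpq
    have hu := norm_sub_sub_smul_le (f := f) (g := g) (u := g p) (ε := ε)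
      (fun s hs => (hfg s (hsub hs)).mono hsub) (fun s hs => by
        rw [← dist_eq_norm]
        refine (hδg s (hsub hs) p (hsub hpm) ?_).le
        rw [Real.dist_eq, abs_of_nonneg (by linarith [hs.1])]
        have : q - p < δ := by rw [hqp]; exact hn
        linarith [hs.2]) hpm hqm hpq
    have hnp : ‖g p‖ = 1 := hg1 p (hsub hpm)
    have hψ : LipschitzWith 1 fun y : R3 => inner ℝ (g p) y := by
      refine LipschitzWith.of_dist_le_mul fun y z => ?_
      rw [Real.dist_eq, ← inner_sub_right, dist_eq_norm]
      simpa [hnp] using abs_real_inner_le_norm (g p) (y - z)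
    have hlen : (1 - ε) / N ≤ inner ℝ (g p) (f q) - inner ℝ (g p) (f p) := by
      have h1 := abs_real_inner_le_norm (g p) (f q - f p - (q - p) • g p)
      rw [inner_sub_right, inner_sub_right, inner_smul_right, real_inner_self_eq_norm_sq, hnp,
        one_mul] at h1
      have h2 := (abs_le.1 (h1.trans hu)).1
      have h3 : (1 - ε) / N = (q - p) - ε * (q - p) := by rw [hqp]; ring
      linarith
    have hcont : ContinuousOn (fun s => inner ℝ (g p) (f s)) (Icc p q) :=
      continuousOn_const.inner (hf.mono hsub)
    calc ENNReal.ofReal ((1 - ε) / N)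
        ≤ volume (Ico (inner ℝ (g p) (f p)) (inner ℝ (g p) (f q))) := by
          rw [Real.volume_Ico]; exact ENNReal.ofReal_le_ofReal hlen
      _ ≤ volume ((fun s => inner ℝ (g p) (f s)) '' Ico p q) :=
          measure_mono (intermediate_value_Ico hpq hcont)
      _ = Measure.hausdorffMeasure 1 ((fun y : R3 => inner ℝ (g p) y) '' (f '' Ico p q)) := by
          rw [image_image, hausdorffMeasure_real]
      _ ≤ Measure.hausdorffMeasure 1 (f '' Ico p q) := by
          simpa using hψ.hausdorffMeasure_image_le zero_le_one (f '' Ico p q)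
  have hsum : ∀ k : ℕ, (k : ℝ) / N ≤ 1 → (k : ℝ≥0∞) * ENNReal.ofReal ((1 - ε) / N) ≤
      Measure.hausdorffMeasure 1 (f '' Ico 0 (k / N)) := by
    intro k
    induction k with
    | zero => intro _; simp
    | succ k ih =>
      intro hk
      push_cast at hk ⊢
      have hkk : (k : ℝ) / N ≤ (k + 1) / N := by gcongr; linarith
      have hk0 : 0 ≤ (k : ℝ) / N := by positivity
      have hs1 : Ico 0 ((k : ℝ) / N) ⊆ Ico 0 1 := Ico_subset_Ico_right (hkk.trans hk)
      have hs2 : Ico ((k : ℝ) / N) ((k + 1) / N) ⊆ Ico 0 1 := Ico_subset_Ico hk0 hk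
      rw [← Ico_union_Ico_eq_Ico hk0 hkk, image_union, measure_union, add_mul, one_mul]
      · exact add_le_add (ih (hkk.trans hk)) (hpiece k hk)
      · rw [disjoint_iff_inter_eq_empty, ← hinj.image_inter hs1 hs2]
        rw [Ico_disjoint_Ico_same.inter_eq, image_empty]
      · exact measurableSet_Ico.image_of_continuousOn_injOn
          (hf.mono (hs2.trans Ico_subset_Icc_self)) (hinj.mono hs2)
  have := hsum (n + 1) (by push_cast; rw [← hN, div_self hNpos.ne'])
  push_cast at this
  rw [← hN, div_self hNpos.ne'] at this
  refine le_trans ?_ this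
  have e : ((n : ℝ≥0∞) + 1) = ENNReal.ofReal N := by
    rw [hN, ENNReal.ofReal_add (by positivity) zero_le_one]; simp
  rw [e, ← ENNReal.ofReal_mul hNpos.le]
  refine ENNReal.ofReal_le_ofReal (le_of_eq ?_)
  field_simp

/-- A simple closed curve through the origin that is `C¹` of unit speed on `[0,1]` is a unit
loop; only its length as a set needs an argument. -/
theorem exists_unitLoop_of_unit_speed {f g : ℝ → R3} (hper : Function.Periodic f 1)
    (hlip : LipschitzWith 1 f)
    (hfg : ∀ s ∈ Icc (0 : ℝ) 1, HasDerivWithinAt f (g s) (Icc 0 1) s)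
    (hg : ContinuousOn g (Icc 0 1)) (hg1 : ∀ s ∈ Icc (0 : ℝ) 1, ‖g s‖ = 1)
    (hinj : InjOn f (Ico 0 1)) (h0 : (0 : R3) ∈ range f) :
    ∃ γ : UnitLoop, γ.toFun = f := by
  refine ⟨⟨f, hper, hlip, ?_, ?_, h0⟩, rfl⟩
  · have hcount : (range ((↑) : ℤ → ℝ)).Countable := countable_range _
    filter_upwards [hcount.ae_notMem volume] with s hs
    have hs0 : Int.fract s ≠ 0 := fun h => hs (by
      obtain ⟨z, hz⟩ := Int.fract_eq_zero_iff.1 h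
      exact ⟨z, hz⟩)
    have hI : Int.fract s ∈ Ioo (0 : ℝ) 1 :=
      ⟨lt_of_le_of_ne (Int.fract_nonneg s) hs0.symm, Int.fract_lt_one s⟩
    have h1 : HasDerivAt f (g (Int.fract s)) (s - ⌊s⌋) :=
      (hfg _ (Ioo_subset_Icc_self hI)).hasDerivAt (Icc_mem_nhds hI.1 hI.2)
    have h2 := HasDerivAt.comp_sub_const s (⌊s⌋ : ℝ) h1
    have e : (fun x : ℝ => f (x - ⌊s⌋)) = f := funext fun x => periodic_one_sub_int hper _ x
    rw [e] at h2
    rw [h2.deriv, hg1 _ (Ioo_subset_Icc_self hI)]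
  · rw [← periodic_one_image_Ico hper]
    refine le_antisymm ?_ (one_le_hausdorffMeasure_image hfg hg hg1 hinj)
    have := hlip.hausdorffMeasure_image_le zero_le_one (Ico (0 : ℝ) 1)
    rw [hausdorffMeasure_real] at this
    simpa using this

/-! ### Unit loops of class `C¹` -/

namespace UnitLoop

variable {γ β : UnitLoop}

theorem hasDerivWithinAt_der (h : γ.IsC1) {s : ℝ} (hs : s ∈ Icc (0 : ℝ) 1) :
    HasDerivWithinAt γ (γ.der s) (Icc 0 1) s :=
  ((h.differentiableOn one_ne_zero) s hs).hasDerivWithinAt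

theorem continuousOn_der (h : γ.IsC1) : ContinuousOn γ.der (Icc 0 1) :=
  h.continuousOn_derivWithin (uniqueDiffOn_Icc zero_lt_one) le_rfl

theorem norm_der (h : γ.IsC1) {s : ℝ} (hs : s ∈ Icc (0 : ℝ) 1) : ‖γ.der s‖ = 1 := by
  have hae : (fun s => ‖γ.der s‖) =ᵐ[volume.restrict (Icc 0 1)] fun _ => 1 := by
    rw [← restrict_Ioo_eq_restrict_Icc]
    filter_upwards [ae_restrict_of_ae γ.unit_speed, ae_restrict_mem measurableSet_Ioo]
      with t ht htI
    rw [der, derivWithin_of_mem_nhds (Icc_mem_nhds htI.1 htI.2)]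
    exact ht
  exact Measure.eqOn_Icc_of_ae_eq volume zero_ne_one hae (continuousOn_der h).norm
    continuousOn_const hs

theorem image_Ico (γ : UnitLoop) : γ '' Ico 0 1 = range γ := periodic_one_image_Ico γ.periodic

theorem apply_one (γ : UnitLoop) : γ 1 = γ 0 := by simpa using γ.periodic 0

theorem norm_apply_le (γ : UnitLoop) (s : ℝ) : ‖γ s‖ ≤ 1 := by
  obtain ⟨t, ht, h0⟩ : (0 : R3) ∈ γ '' Ico 0 1 := by rw [γ.image_Ico]; exact γ.origin_mem
  rw [← periodic_one_fract γ.periodic s]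
  have := γ.lipschitz.dist_le_mul (Int.fract s) t
  rw [h0, dist_zero_right, Real.dist_eq] at this
  have h1 : |Int.fract s - t| ≤ 1 :=
    abs_le.2 ⟨by linarith [Int.fract_nonneg s, ht.2], by linarith [Int.fract_lt_one s, ht.1]⟩
  simpa using this.trans (mul_le_mul_of_nonneg_left h1 (by positivity))

/-- If two `C¹` loops have `ε`-close velocities, their difference is `ε`-Lipschitz for the
intrinsic distance of the circle; the velocities need not match at the base point. -/
theorem norm_sub_sub_le_intrinsicDist (hγ : γ.IsC1) (hβ : β.IsC1) {ε : ℝ}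
    (h : ∀ s ∈ Icc (0 : ℝ) 1, ‖γ.der s - β.der s‖ ≤ ε) {s t : ℝ} (hs : s ∈ Icc (0 : ℝ) 1)
    (ht : t ∈ Icc (0 : ℝ) 1) :
    ‖(γ s - β s) - (γ t - β t)‖ ≤ ε * intrinsicDist s t := by
  have hd : ∀ x ∈ Icc (0 : ℝ) 1,
      HasDerivWithinAt (fun x => γ x - β x) (γ.der x - β.der x) (Icc 0 1) x := fun x hx =>
    (hasDerivWithinAt_der hγ hx).sub (hasDerivWithinAt_der hβ hx)
  have hL : ∀ x ∈ Icc (0 : ℝ) 1, ∀ y ∈ Icc (0 : ℝ) 1,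
      ‖(γ x - β x) - (γ y - β y)‖ ≤ ε * |x - y| := fun x hx y hy =>
    (convex_Icc 0 1).norm_image_sub_le_of_norm_hasDerivWithin_le hd h hy hx
  have key : ∀ x ∈ Icc (0 : ℝ) 1, ∀ y ∈ Icc (0 : ℝ) 1, x ≤ y →
      ‖(γ x - β x) - (γ y - β y)‖ ≤ ε * (1 - |x - y|) := fun x hx y hy hxy => by
    have h1 := hL x hx 0 (by simp)
    have h2 := hL 1 (by simp) y hy
    rw [γ.apply_one, β.apply_one] at h2
    have h3 := norm_add_le (γ x - β x - (γ 0 - β 0)) (γ 0 - β 0 - (γ y - β y))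
    rw [sub_add_sub_cancel] at h3
    rw [abs_of_nonneg (by linarith [hx.1])] at h1
    rw [abs_of_nonneg (by linarith [hy.2])] at h2
    rw [abs_of_nonpos (by linarith)]
    calc _ ≤ _ := h3
      _ ≤ ε * (x - 0) + ε * (1 - y) := add_le_add h1 h2
      _ = ε * (1 - -(x - y)) := by ring
  have hε : 0 ≤ ε := (norm_nonneg _).trans (h s hs)
  rw [intrinsicDist, mul_min_of_nonneg _ _ hε]
  refine le_min (hL s hs t ht) ?_
  rcases le_total s t with hst | hst
  · exact key s hs t ht hst
  · rw [norm_sub_rev, abs_sub_comm]; exact key t ht s hs hst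

theorem intrinsicDist_nonneg {s t : ℝ} (hs : s ∈ Icc (0 : ℝ) 1) (ht : t ∈ Icc (0 : ℝ) 1) :
    0 ≤ intrinsicDist s t := by
  refine le_min (abs_nonneg _) (sub_nonneg.2 (abs_le.2 ⟨?_, ?_⟩)) <;>
    linarith [hs.1, hs.2, ht.1, ht.2]

/-- Loops that are `C¹`-close to a bi-Lipschitz embedded `C¹` loop are ambient isotopic to it. -/
theorem eventually_knotType_eq {γs : ℕ → UnitLoop} (hs : ∀ i, (γs i).IsC1) (hγ : γ.IsC1)
    (hlim : TendstoC1 γs γ) {c : ℝ} (hc : 0 < c)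
    (hbi : ∀ s ∈ Icc (0 : ℝ) 1, ∀ t ∈ Icc (0 : ℝ) 1, c * intrinsicDist s t ≤ ‖γ s - γ t‖) :
    ∀ᶠ i in atTop, (γs i).knotType = γ.knotType := by
  obtain ⟨ε, hε, hiso⟩ := exists_ambientIsotopic_of_lipschitz_displacement
  filter_upwards [Metric.tendstoUniformlyOn_iff.1 hlim.2 (ε * c) (by positivity)] with i hi
  refine Quotient.sound (AmbientIsotopic.symm ?_)
  have := hiso (Ico (0 : ℝ) 1) (fun s => γ s) (fun s => γs i s) fun s t => by
    have hs' := Ico_subset_Icc_self s.2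
    have ht' := Ico_subset_Icc_self t.2
    refine (norm_sub_sub_le_intrinsicDist (hs i) hγ (ε := ε * c) (fun x hx => ?_)
      hs' ht').trans ?_
    · rw [← dist_eq_norm, dist_comm]; exact (hi x hx).le
    · rw [mul_assoc]
      exact mul_le_mul_of_nonneg_left (hbi _ hs' _ ht') hε.le
  have hr : ∀ β : UnitLoop, (range fun s : Ico (0 : ℝ) 1 => β s) = β.carrier := fun β => by
    rw [carrier, ← β.image_Ico, image_eq_range]
  rwa [hr, hr] at this

/-! ### Hölder bounds -/

theorem norm_der_sub_le {α : ℝ} (hα : 0 < α) {C : ℝ≥0} (h : γ.c1aNorm α ≤ C) {s t : ℝ}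
    (hs : s ∈ Icc (0 : ℝ) 1) (ht : t ∈ Icc (0 : ℝ) 1) :
    ‖γ.der s - γ.der t‖ ≤ C * |s - t| ^ α := by
  rcases eq_or_ne s t with rfl | hne
  · simp [hα.ne']
  have hpos : 0 < |s - t| ^ α := Real.rpow_pos_of_pos (abs_pos.2 (sub_ne_zero.2 hne)) α
  have h1 : ‖γ.der s - γ.der t‖ₑ / ENNReal.ofReal (|s - t| ^ α) ≤ C := by
    refine le_trans ?_ ((self_le_add_left _ _).trans h)
    exact le_iSup₂_of_le s hs (le_iSup₂_of_le t ht (le_iSup_of_le hne le_rfl))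
  rw [ENNReal.div_le_iff (by simpa using hpos) ENNReal.ofReal_ne_top] at h1
  have h2 := ENNReal.toReal_mono (by finiteness) h1
  rwa [ENNReal.toReal_mul, ENNReal.toReal_ofReal hpos.le, toReal_enorm,
    ENNReal.coe_toReal] at h2

/-- A Hölder bound for the velocity yields a modulus of continuity that depends on the constants
only. -/
theorem exists_modulus {α : ℝ} (hα : 0 < α) (C : ℝ≥0) {ε : ℝ} (hε : 0 < ε) :
    ∃ η : ℝ, 0 < η ∧ ∀ γ : UnitLoop, γ.c1aNorm α ≤ C → ∀ s ∈ Icc (0 : ℝ) 1,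
      ∀ t ∈ Icc (0 : ℝ) 1, |s - t| ≤ η → ‖γ.der s - γ.der t‖ ≤ ε := by
  have hlim : Tendsto (fun x : ℝ => (C : ℝ) * x ^ α) (𝓝 0) (𝓝 0) := by
    have : ContinuousAt (fun x : ℝ => (C : ℝ) * x ^ α) 0 :=
      continuousAt_const.mul (Real.continuousAt_rpow_const 0 α (Or.inr hα.le))
    simpa [ContinuousAt, hα.ne'] using this
  obtain ⟨η, hη, hball⟩ := Metric.eventually_nhds_iff.1 (hlim.eventually (gt_mem_nhds hε))
  refine ⟨η / 2, by positivity, fun γ h s hs t ht hst =>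
    (norm_der_sub_le hα h hs ht).trans (hball ?_).le⟩
  rw [dist_zero_right, Real.norm_eq_abs, abs_abs]
  linarith

end UnitLoop

/-! ### Compactness of families of loops with Hölder bounds -/

namespace UnitLoop

theorem intrinsicDist_pos {s t : ℝ} (hs : s ∈ Ico (0 : ℝ) 1) (ht : t ∈ Ico (0 : ℝ) 1)
    (hst : s ≠ t) : 0 < intrinsicDist s t := by
  refine lt_min (abs_pos.2 (sub_ne_zero.2 hst)) (sub_pos.2 (abs_lt.2 ⟨?_, ?_⟩)) <;>
    linarith [hs.1, hs.2, ht.1, ht.2]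

/-- The quantitative embeddedness at scale `δ` that the theorem requires, uniformly, of all
loops below an energy level. -/
def IsSeparated (γ : UnitLoop) (δ : ℝ) : Prop :=
  ∀ s ∈ Icc (0 : ℝ) 1, ∀ t ∈ Icc (0 : ℝ) 1, 0 < intrinsicDist s t →
    min δ (intrinsicDist s t / 2) < ‖γ s - γ t‖

/-- The equicontinuous families of loops and of their velocities have subsequences that converge
uniformly. -/
theorem exists_uniform_limit {γs : ℕ → UnitLoop} {α : ℝ} (hα : 0 < α) {C : ℝ≥0}
    (h1 : ∀ i, (γs i).IsC1) (hC : ∀ i, (γs i).c1aNorm α ≤ C) :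
    ∃ (φ : ℕ → ℕ) (f g : ℝ → R3), StrictMono φ ∧ Function.Periodic f 1 ∧
      ContinuousOn g (Icc 0 1) ∧
      TendstoUniformlyOn (fun i => (γs (φ i)).toFun) f atTop (Icc 0 1) ∧
      TendstoUniformlyOn (fun i => (γs (φ i)).der) g atTop (Icc 0 1) := by
  let G : ℕ → BoundedContinuousFunction (Icc (0 : ℝ) 1) (R3 × R3) := fun i =>
    BoundedContinuousFunction.mkOfCompact
      ⟨fun x => (γs i x, (γs i).der x), ((γs i).lipschitz.continuous.comp
        continuous_subtype_val).prodMk (continuousOn_der (h1 i)).domRestrict⟩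
  have hGa : ∀ i x, G i x = (γs i x, (γs i).der x) := fun i x => rfl
  have hcpt : IsCompact (closure (range G)) := by
    refine BoundedContinuousFunction.arzela_ascoli (Metric.closedBall 0 1)
      (isCompact_closedBall 0 1) _ ?_ ?_
    · rintro _ x ⟨i, rfl⟩
      rw [mem_closedBall_zero_iff, hGa, Prod.norm_def]
      exact max_le ((γs i).norm_apply_le x) (norm_der (h1 i) x.2).le
    · intro x
      refine Metric.equicontinuousAt_iff.2 fun ε hε => ?_
      obtain ⟨η, hη, hmod⟩ := exists_modulus hα C (half_pos hε)
      refine ⟨min η ε, lt_min hη hε, fun y hy ⟨_, i, hi⟩ => ?_⟩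
      subst hi
      change dist (G i x) (G i y) < ε
      rw [dist_comm] at hy
      have hxy : dist (x : ℝ) y < min η ε := hy
      rw [hGa, hGa, Prod.dist_eq]
      refine max_lt ?_ ?_
      · have := (γs i).lipschitz.dist_le_mul x y
        rw [NNReal.coe_one, one_mul] at this
        exact this.trans_lt (hxy.trans_le (min_le_right _ _))
      · rw [dist_eq_norm]
        have := hmod (γs i) (hC i) x x.2 y y.2 (hxy.trans_le (min_le_left _ _)).le
        linarith
  obtain ⟨F, -, φ, hφ, hF⟩ :=
    hcpt.tendsto_subseq fun i => subset_closure (mem_range_self (f := G) i)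
  have hU := Metric.tendstoUniformly_iff.1
    (BoundedContinuousFunction.tendsto_iff_tendstoUniformly.1 hF)
  have hfr : ∀ x : ℝ, Int.fract x ∈ Icc (0 : ℝ) 1 := fun x =>
    ⟨Int.fract_nonneg x, (Int.fract_lt_one x).le⟩
  refine ⟨φ, fun x => (F ⟨Int.fract x, hfr x⟩).1, fun x => (F (projIcc 0 1 zero_le_one x)).2, hφ,
    fun x => ?_, ?_, Metric.tendstoUniformlyOn_iff.2 fun ε hε => ?_,
    Metric.tendstoUniformlyOn_iff.2 fun ε hε => ?_⟩
  · simp only [Int.fract_add_one]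
  · exact (continuous_snd.comp (F.continuous.comp continuous_projIcc)).continuousOn
  · filter_upwards [hU ε hε] with i hi x _
    refine lt_of_le_of_lt ?_ (hi ⟨Int.fract x, hfr x⟩)
    have e : (γs (φ i)) x = (G (φ i) ⟨Int.fract x, hfr x⟩).1 :=
      (periodic_one_fract (γs (φ i)).periodic x).symm
    rw [e]
    exact le_max_left _ _
  · filter_upwards [hU ε hε] with i hi x hx
    refine lt_of_le_of_lt ?_ (hi (projIcc 0 1 zero_le_one x))
    have e : (γs (φ i)).der x = (G (φ i) (projIcc 0 1 zero_le_one x)).2 := by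
      rw [projIcc_of_mem zero_le_one hx]; rfl
    rw [e]
    exact le_max_right _ _

/-- A family of loops with a common `C^{1,α}` bound and a common bi-Lipschitz bound is
sequentially compact in `C¹`, within the class of unit loops. -/
theorem exists_tendstoC1_subseq {γs : ℕ → UnitLoop} {α : ℝ} (hα : 0 < α) {C : ℝ≥0}
    (h1 : ∀ i, (γs i).IsC1) (hC : ∀ i, (γs i).c1aNorm α ≤ C) {δ : ℝ} (hδ : 0 < δ)
    (hbi : ∀ i, (γs i).IsSeparated δ) :
    ∃ (φ : ℕ → ℕ) (γ : UnitLoop), StrictMono φ ∧ γ.IsC1 ∧ γ.IsSimple ∧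
      TendstoC1 (fun i => γs (φ i)) γ ∧ ∃ c : ℝ, 0 < c ∧
      ∀ s ∈ Icc (0 : ℝ) 1, ∀ t ∈ Icc (0 : ℝ) 1, c * intrinsicDist s t ≤ ‖γ s - γ t‖ := by
  obtain ⟨φ, f, g, hφ, hper, hgc, hf, hg⟩ := exists_uniform_limit hα h1 hC
  have hfl : ∀ x, Tendsto (fun i => γs (φ i) x) atTop (𝓝 (f x)) := fun x => by
    have := hf.tendsto_at (x := Int.fract x) ⟨Int.fract_nonneg x, (Int.fract_lt_one x).le⟩
    rw [periodic_one_fract hper] at this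
    exact this.congr fun i => periodic_one_fract (γs (φ i)).periodic x
  have hgl : ∀ x ∈ Icc (0 : ℝ) 1, Tendsto (fun i => (γs (φ i)).der x) atTop (𝓝 (g x)) :=
    fun x hx => hg.tendsto_at hx
  have hlip : LipschitzWith 1 f := LipschitzWith.of_dist_le_mul fun x y =>
    le_of_tendsto ((hfl x).dist (hfl y))
      (Eventually.of_forall fun i => (γs (φ i)).lipschitz.dist_le_mul x y)
  have hg1 : ∀ s ∈ Icc (0 : ℝ) 1, ‖g s‖ = 1 := fun s hs =>
    tendsto_nhds_unique (hgl s hs).norm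
      (tendsto_const_nhds.congr fun i => (norm_der (h1 (φ i)) hs).symm)
  have hderiv : ∀ s ∈ Icc (0 : ℝ) 1, HasDerivWithinAt f (g s) (Icc 0 1) s := by
    intro s hs
    rw [hasDerivWithinAt_iff_isLittleO, Asymptotics.isLittleO_iff]
    intro ε hε
    obtain ⟨η, hη, hmod⟩ := exists_modulus hα C hε
    filter_upwards [inter_mem_nhdsWithin _ (Metric.ball_mem_nhds s hη)] with t ht
    -- The estimate for the approximating loops is uniform, and passes to the limit.
    have hts : |t - s| < η := ht.2
    refine le_of_tendsto (((hfl t).sub (hfl s)).sub ((hgl s hs).const_smul (t - s))).norm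
      (Eventually.of_forall fun i => ?_)
    have hest : ∀ a ∈ Icc (0 : ℝ) 1, ∀ b ∈ Icc (0 : ℝ) 1, a ≤ b → s ∈ Icc a b → b - a < η →
        ‖γs (φ i) b - γs (φ i) a - (b - a) • (γs (φ i)).der s‖ ≤ ε * (b - a) := by
      intro a ha b hb hab hsab hη'
      have hsub : Icc a b ⊆ Icc 0 1 := Icc_subset_Icc ha.1 hb.2
      refine norm_sub_sub_smul_le (g := (γs (φ i)).der)
        (fun x hx => (hasDerivWithinAt_der (h1 (φ i)) (hsub hx)).mono hsub)
        (fun x hx => hmod _ (hC (φ i)) x (hsub hx) s hs ?_) (left_mem_Icc.2 hab)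
        (right_mem_Icc.2 hab) hab
      rw [abs_le]
      constructor <;> linarith [hx.1, hx.2, hsab.1, hsab.2]
    rw [Real.norm_eq_abs]
    rcases le_total s t with hst | hst
    · rw [abs_of_nonneg (sub_nonneg.2 hst)] at hts ⊢
      exact hest s hs t ht.1 hst (left_mem_Icc.2 hst) hts
    · rw [abs_of_nonpos (sub_nonpos.2 hst), neg_sub] at hts ⊢
      have := hest t ht.1 s hs hst (right_mem_Icc.2 hst) hts
      rw [← norm_neg] at this
      have e : -(γs (φ i) s - γs (φ i) t - (s - t) • (γs (φ i)).der s)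
          = γs (φ i) t - γs (φ i) s - (t - s) • (γs (φ i)).der s := by module
      rwa [e] at this
  have hlow : ∀ s ∈ Icc (0 : ℝ) 1, ∀ t ∈ Icc (0 : ℝ) 1,
      min δ (intrinsicDist s t / 2) ≤ ‖f s - f t‖ := fun s hs t ht => by
    rcases (intrinsicDist_nonneg hs ht).eq_or_lt with h0 | h0
    · rw [← h0, zero_div, min_eq_right hδ.le]; exact norm_nonneg _
    · exact ge_of_tendsto ((hfl s).sub (hfl t)).norm
        (Eventually.of_forall fun i => (hbi (φ i) s hs t ht h0).le)
  have hinj : InjOn f (Ico 0 1) := fun s hs t ht hst => by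
    by_contra hne
    have h2 := hlow s (Ico_subset_Icc_self hs) t (Ico_subset_Icc_self ht)
    rw [hst, sub_self, norm_zero] at h2
    exact absurd h2 (not_le.2 (lt_min hδ (half_pos (intrinsicDist_pos hs ht hne))))
  have h0 : (0 : R3) ∈ range f := by
    have hcl : IsClosed (range f) := by
      rw [← hper.image_Icc one_pos 0]
      exact (isCompact_Icc.image hlip.continuous).isClosed
    rw [← hcl.closure_eq, Metric.mem_closure_iff]
    intro ε hε
    obtain ⟨i, hi⟩ := (Metric.tendstoUniformlyOn_iff.1 hf ε hε).exists
    obtain ⟨s, hs, hs0⟩ : (0 : R3) ∈ γs (φ i) '' Ico 0 1 := by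
      rw [(γs (φ i)).image_Ico]; exact (γs (φ i)).origin_mem
    refine ⟨f s, mem_range_self s, ?_⟩
    rw [← hs0, dist_comm]
    exact hi s (Ico_subset_Icc_self hs)
  obtain ⟨γ, rfl⟩ := exists_unitLoop_of_unit_speed hper hlip hderiv hgc hg1 hinj h0
  have hder : EqOn γ.der g (Icc 0 1) := fun s hs =>
    (hderiv s hs).derivWithin (uniqueDiffOn_Icc zero_lt_one s hs)
  refine ⟨φ, γ, hφ, ?_, hinj, ⟨hf, hg.congr_right hder.symm⟩, min (2 * δ) (1 / 2),
    by positivity, fun s hs t ht => ?_⟩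
  · refine (contDiffOn_one_iff_derivWithin (uniqueDiffOn_Icc zero_lt_one)).2 ⟨fun s hs =>
      (hderiv s hs).differentiableWithinAt, hgc.congr hder⟩
  · -- As `d ≤ 1/2`, the bound `min δ (d/2)` is at least `min (2δ) (1/2) * d`.
    refine le_trans ?_ (hlow s hs t ht)
    have hd0 := intrinsicDist_nonneg hs ht
    have hd : intrinsicDist s t ≤ 1 / 2 := by
      rcases le_total |s - t| (1 / 2) with h | h
      · exact (min_le_left _ _).trans h
      · exact (min_le_right _ _).trans (by linarith)
    refine le_min ?_ ?_
    · have := mul_le_mul_of_nonneg_right (min_le_left (2 * δ) (1 / 2)) hd0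
      nlinarith
    · have := mul_le_mul_of_nonneg_right (min_le_right (2 * δ) (1 / 2)) hd0
      linarith

/-! ### Short arcs of loops with Hölder bounds are unknotted -/

/-- The separation hypothesis, on the periodic extension of the loop. -/
theorem min_lt_norm_sub_of_lt {γ : UnitLoop} {δ : ℝ}
    (hbi : γ.IsSeparated δ) {a b : ℝ} (hab : a < b) (hab1 : b < a + 1) :
    min δ (min (b - a) (1 - (b - a)) / 2) < ‖γ a - γ b‖ := by
  have hI : ∀ x : ℝ, Int.fract x ∈ Icc (0 : ℝ) 1 := fun x =>
    ⟨Int.fract_nonneg x, (Int.fract_lt_one x).le⟩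
  have hd : intrinsicDist (Int.fract a) (Int.fract b) = min (b - a) (1 - (b - a)) := by
    have ha := Int.floor_add_fract a
    have hb := Int.floor_add_fract b
    have h1 := Int.fract_nonneg a
    have h2 := Int.fract_nonneg b
    have h3 := Int.fract_lt_one a
    have h4 := Int.fract_lt_one b
    have h5 : ⌊b⌋ = ⌊a⌋ ∨ ⌊b⌋ = ⌊a⌋ + 1 := by
      have h6 : ⌊a⌋ ≤ ⌊b⌋ := Int.floor_mono hab.le
      have h7 : ⌊b⌋ ≤ ⌊a⌋ + 1 := by
        rw [← Int.floor_add_one]; exact Int.floor_mono hab1.le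
      omega
    rcases h5 with h5 | h5
    · have e : Int.fract a - Int.fract b = -(b - a) := by rw [h5] at hb; linarith
      rw [intrinsicDist, e, abs_neg, abs_of_pos (sub_pos.2 hab)]
    · have e : Int.fract a - Int.fract b = 1 - (b - a) := by
        rw [h5] at hb; push_cast at hb; linarith
      rw [intrinsicDist, e, abs_of_pos (by linarith), sub_sub_cancel, min_comm]
  have := hbi _ (hI a) _ (hI b) (by rw [hd]; exact lt_min (by linarith) (by linarith))
  rwa [hd, periodic_one_fract γ.periodic, periodic_one_fract γ.periodic] at this

/-- Along a short arc, even across a corner at the base point, some linear functional increases: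
by the separation hypothesis the two one-sided velocities `u`, `v` at the corner satisfy
`‖u + v‖ ≥ 7/8`, so that both have a positive product with `u + v`. -/
theorem exists_inner_pos {γ : UnitLoop} {δ η : ℝ} (h1 : γ.IsC1) (hη : 0 < η) (hη4 : η ≤ 1 / 4)
    (hηδ : η ≤ δ)
    (hmod : ∀ s ∈ Icc (0 : ℝ) 1, ∀ t ∈ Icc (0 : ℝ) 1, |s - t| ≤ η →
      ‖γ.der s - γ.der t‖ ≤ 1 / 16)
    (hbi : γ.IsSeparated δ) {a b : ℝ} (hb0 : 0 ≤ b) (hb1 : b < 1)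
    (hba : b - a ≤ η) :
    ∃ w : R3, ∀ s ∈ Icc a b, ∀ t ∈ Icc a b, s < t → 0 < inner ℝ (γ t - γ s) w := by
  have happrox : ∀ p ∈ Icc (0 : ℝ) 1, ∀ q ∈ Icc (0 : ℝ) 1, q - p ≤ η → ∀ c ∈ Icc p q,
      ∀ s ∈ Icc p q, ∀ t ∈ Icc p q, s ≤ t →
      ‖γ t - γ s - (t - s) • γ.der c‖ ≤ 1 / 16 * (t - s) := by
    intro p hp q hq hpq c hc s hs t ht hst
    have hsub : Icc p q ⊆ Icc 0 1 := Icc_subset_Icc hp.1 hq.2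
    refine norm_sub_sub_smul_le (g := γ.der)
      (fun x hx => (hasDerivWithinAt_der h1 (hsub hx)).mono hsub)
      (fun x hx => hmod x (hsub hx) c (hsub hc) ?_) hs ht hst
    rw [abs_le]
    constructor <;> linarith [hx.1, hx.2, hc.1, hc.2]
  have hpos : ∀ (z u w : R3) (l : ℝ), 0 < l → ‖z - l • u‖ ≤ 1 / 16 * l →
      ‖w‖ / 16 < inner ℝ u w → 0 < inner ℝ z w := by
    intro z u w l hl hz huw
    have h2 := (abs_le.1 ((abs_real_inner_le_norm (z - l • u) w).trans
      (mul_le_mul_of_nonneg_right hz (norm_nonneg w)))).1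
    rw [inner_sub_left, inner_smul_left, conj_trivial] at h2
    nlinarith
  rcases le_or_gt 0 a with ha0 | ha0
  · -- The arc does not pass through the base point.
    rcases le_or_gt a b with hab | hab
    swap
    · exact ⟨0, fun s hs => absurd (hs.1.trans hs.2) (not_le.2 hab)⟩
    have haI : a ∈ Icc (0 : ℝ) 1 := ⟨ha0, hab.trans hb1.le⟩
    refine ⟨γ.der a, fun s hs t ht hst => hpos _ (γ.der a) _ (t - s) (sub_pos.2 hst)
      (happrox a haI b ⟨hb0, hb1.le⟩ hba a (left_mem_Icc.2 hab) s hs t ht hst.le) ?_⟩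
    rw [real_inner_self_eq_norm_sq, norm_der h1 haI]
    norm_num
  · set u : R3 := γ.der 0 with hu
    set v : R3 := γ.der 1 with hv
    have hu1 : ‖u‖ = 1 := norm_der h1 (by simp)
    have hv1 : ‖v‖ = 1 := norm_der h1 (by simp)
    have hη1 : η ∈ Icc (0 : ℝ) 1 := ⟨hη.le, by linarith⟩
    have hη2 : 1 - η ∈ Icc (0 : ℝ) 1 := ⟨by linarith, by linarith⟩
    have hw : 7 / 8 ≤ ‖u + v‖ := by
      have e1 := happrox 0 (by simp) η hη1 (by linarith) 0 (left_mem_Icc.2 hη.le)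
        0 (left_mem_Icc.2 hη.le) η (right_mem_Icc.2 hη.le) hη.le
      have e2 := happrox (1 - η) hη2 1 (by simp) (by linarith) 1 (right_mem_Icc.2 hη2.2)
        (1 - η) (left_mem_Icc.2 hη2.2) 1 (right_mem_Icc.2 hη2.2) hη2.2
      rw [sub_zero] at e1
      rw [sub_sub_cancel, γ.apply_one] at e2
      have hd : intrinsicDist η (1 - η) = 2 * η := by
        rw [intrinsicDist, abs_of_nonpos (by linarith), min_eq_right (by linarith)]
        ring
      have e3 := hbi η hη1 (1 - η) hη2 (by rw [hd]; linarith)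
      rw [hd, mul_div_cancel_left₀ _ two_ne_zero, min_eq_right hηδ] at e3
      have e4 : γ η - γ (1 - η) = (γ η - γ 0 - η • u) + (γ 0 - γ (1 - η) - η • v)
          + η • (u + v) := by module
      rw [e4] at e3
      have e5 := norm_add₃_le (a := γ η - γ 0 - η • u) (b := γ 0 - γ (1 - η) - η • v)
        (c := η • (u + v))
      rw [norm_smul, Real.norm_of_nonneg hη.le] at e5
      by_contra hlt
      nlinarith
    have hw2 : ‖u + v‖ ≤ 2 := by linarith [norm_add_le u v]
    have huv : ‖u + v‖ ^ 2 = 2 + 2 * inner ℝ u v := by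
      rw [norm_add_sq_real, hu1, hv1]; ring
    have hpu : ‖u + v‖ / 16 < inner ℝ u (u + v) := by
      rw [inner_add_right, real_inner_self_eq_norm_sq, hu1]; nlinarith
    have hpv : ‖u + v‖ / 16 < inner ℝ v (u + v) := by
      rw [inner_add_right, real_inner_self_eq_norm_sq, hv1, real_inner_comm]; nlinarith
    have hright : ∀ s, 0 ≤ s → ∀ t, t ≤ b → s < t → 0 < inner ℝ (γ t - γ s) (u + v) := by
      intro s hs t ht hst
      refine hpos _ u _ (t - s) (sub_pos.2 hst) (happrox 0 (by simp) b ⟨hb0, hb1.le⟩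
        (by linarith) 0 (left_mem_Icc.2 hb0) s ⟨hs, by linarith⟩ t ⟨by linarith, ht⟩ hst.le) hpu
    have hleft : ∀ s, a ≤ s → ∀ t, t ≤ 0 → s < t → 0 < inner ℝ (γ t - γ s) (u + v) := by
      intro s hs t ht hst
      have := happrox (a + 1) ⟨by linarith, by linarith⟩ 1 (by simp) (by linarith) 1
        (right_mem_Icc.2 (by linarith)) (s + 1) ⟨by linarith, by linarith⟩ (t + 1)
        ⟨by linarith, by linarith⟩ (by linarith)
      rw [γ.periodic, γ.periodic, add_sub_add_right_eq_sub] at this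
      exact hpos _ v _ (t - s) (sub_pos.2 hst) this hpv
    refine ⟨u + v, fun s hs t ht hst => ?_⟩
    rcases le_or_gt 0 s with hs0 | hs0
    · exact hright s hs0 t ht.2 hst
    rcases le_or_gt t 0 with ht0 | ht0
    · exact hleft s hs.1 t ht0 hst
    · have := add_pos (hright 0 le_rfl t ht.2 ht0) (hleft s hs.1 0 le_rfl hs0)
      rwa [← inner_add_left, sub_add_sub_cancel] at this

/-- Proper arcs of such a loop in sufficiently small balls are unknotted. -/
theorem isTrivialBallArc_of_small {γ : UnitLoop} {δ η : ℝ} (h1 : γ.IsC1) (hη : 0 < η)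
    (hη4 : η ≤ 1 / 4) (hηδ : η ≤ δ)
    (hmod : ∀ s ∈ Icc (0 : ℝ) 1, ∀ t ∈ Icc (0 : ℝ) 1, |s - t| ≤ η →
      ‖γ.der s - γ.der t‖ ≤ 1 / 16)
    (hbi : γ.IsSeparated δ) {a b r : ℝ} {x : R3}
    (harc : γ.IsProperArc a b x r) (hr : 4 * r ≤ η) :
    IsTrivialBallArc (Metric.closedBall x r) (γ '' Icc a b) := by
  obtain ⟨hr0, hab, hab1, -, ha, hb, hI⟩ := harc
  have hball : ∀ s ∈ Icc a b, γ s ∈ Metric.closedBall x r := fun s hs => by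
    rcases hs.1.eq_or_lt with rfl | h2
    · exact Metric.sphere_subset_closedBall ha
    rcases hs.2.eq_or_lt with rfl | h3
    · exact Metric.sphere_subset_closedBall hb
    · exact Metric.ball_subset_closedBall (hI (mem_image_of_mem _ ⟨h2, h3⟩))
  have hdist : ∀ s ∈ Icc a b, ‖γ a - γ s‖ ≤ 2 * r := fun s hs => by
    have h2 := dist_triangle_right (γ a) (γ s) x
    have h3 := Metric.mem_closedBall.1 (hball s hs)
    rw [Metric.mem_sphere.1 ha, dist_eq_norm] at h2
    linarith
  -- Otherwise `[a,b]` would be nearly a full period, and contain `a + 1/2`.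
  have hlen : b - a ≤ η := by
    by_contra hlt
    push Not at hlt
    have h2 := (min_lt_norm_sub_of_lt hbi hab hab1).trans_le (hdist b (right_mem_Icc.2 hab.le))
    have h3 : min (b - a) (1 - (b - a)) / 2 < 2 * r :=
      (min_lt_iff.1 h2).resolve_left (by linarith)
    have h4 : 1 - (b - a) < 4 * r := by
      have h5 : min (b - a) (1 - (b - a)) < 4 * r := by linarith
      exact (min_lt_iff.1 h5).resolve_left (by linarith)
    have h6 := (min_lt_norm_sub_of_lt hbi (a := a) (b := a + 1 / 2) (by linarith)
      (by linarith)).trans_le (hdist (a + 1 / 2) ⟨by linarith, by linarith⟩)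
    rw [add_sub_cancel_left] at h6
    have h7 := (min_lt_iff.1 h6).resolve_left (by linarith)
    norm_num at h7
    linarith
  -- Shift the parameter so that `b` lies in `[0,1)`.
  have hshift := periodic_one_sub_int γ.periodic ⌊b⌋
  obtain ⟨w, hw⟩ := exists_inner_pos h1 hη hη4 hηδ hmod hbi (a := a - ⌊b⌋) (b := b - ⌊b⌋)
    (Int.fract_nonneg b) (Int.fract_lt_one b) (by linarith)
  refine isTrivialBallArc_of_strictMonoOn hr0 hab γ.lipschitz.continuous.continuousOn
    (fun s hs t ht hst => ?_) ha hb hI (w := w)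
  have := hw (s - ⌊b⌋) ⟨by linarith [hs.1], by linarith [hs.2]⟩ (t - ⌊b⌋)
    ⟨by linarith [ht.1], by linarith [ht.2]⟩ (by linarith)
  rwa [hshift, hshift] at this

end UnitLoop

/-! ### Knot classes contain unit loops -/

/-- The circle-equivariant inverse of the normalized arclength function of a closed curve with
speed `v`. -/
theorem exists_arclength_inverse {v : ℝ → ℝ} (hv : Continuous v) (hper : Function.Periodic v 1)
    (hpos : ∀ s, 0 < v s) :
    ∃ (L : ℝ) (τ : ℝ ≃o ℝ), 0 < L ∧ (∀ y, HasDerivAt τ (L / v (τ y)) y) ∧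
      (∀ y, τ (y + 1) = τ y + 1) ∧ τ 0 = 0 := by
  have hint : ∀ a b, IntervalIntegrable v volume a b := fun a b => hv.intervalIntegrable a b
  set L : ℝ := ∫ x in (0:ℝ)..1, v x with hL
  have hLpos : 0 < L := intervalIntegral.intervalIntegral_pos_of_pos (hint 0 1) hpos one_pos
  set σ : ℝ → ℝ := fun s => (∫ x in (0:ℝ)..s, v x) / L with hσ
  have hσd : ∀ s, HasDerivAt σ (v s / L) s := fun s =>
    (intervalIntegral.integral_hasDerivAt_right (hint 0 s)
      (hv.stronglyMeasurableAtFilter _ _) hv.continuousAt).div_const L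
  have hσc : Continuous σ := continuous_iff_continuousAt.2 fun s => (hσd s).continuousAt
  have hσm : StrictMono σ := strictMono_of_deriv_pos fun s => by
    rw [(hσd s).deriv]; exact div_pos (hpos s) hLpos
  have hσ1 : ∀ s, σ (s + 1) = σ s + 1 := fun s => by
    simp only [hσ]
    rw [← intervalIntegral.integral_add_adjacent_intervals (hint 0 s) (hint s (s + 1)),
      hper.intervalIntegral_add_eq s 0, zero_add, add_div, ← hL, div_self hLpos.ne']
  have hσ0 : σ 0 = 0 := by simp [hσ]
  have hσn : ∀ n : ℤ, σ n = n := fun n => by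
    have hp : Function.Periodic (fun s => σ s - s) 1 := fun s => by
      simp only [hσ1]; ring
    have := periodic_one_sub_int hp n n
    simp only [sub_self, hσ0] at this
    linarith
  have hsurj : Function.Surjective σ := fun y => by
    have h1 : (⌊y⌋ : ℝ) ≤ (⌊y⌋ + 1 : ℤ) := by push_cast; linarith
    obtain ⟨s, -, hs⟩ := intermediate_value_Icc h1 hσc.continuousOn
      (show y ∈ Icc (σ ⌊y⌋) (σ (⌊y⌋ + 1 : ℤ)) by
        rw [hσn, hσn]; push_cast; exact ⟨Int.floor_le y, (Int.lt_floor_add_one y).le⟩)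
    exact ⟨s, hs⟩
  set e := hσm.orderIsoOfSurjective σ hsurj with he
  have heσ : ∀ s, e s = σ s := fun s => rfl
  refine ⟨L, e.symm, hLpos, fun y => ?_, fun y => ?_, ?_⟩
  · have := HasDerivAt.of_local_left_inverse (f := σ) (g := e.symm) (a := y)
      e.symm.continuous.continuousAt (hσd (e.symm y)) (div_pos (hpos _) hLpos).ne'
      (Eventually.of_forall fun z => e.apply_symm_apply z)
    rwa [inv_div] at this
  · rw [OrderIso.symm_apply_eq, heσ, hσ1, ← heσ, e.apply_symm_apply]
  · rw [OrderIso.symm_apply_eq, heσ, hσ0]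

/-- Every knot class contains a unit loop: parametrize by arclength, rescale and translate. -/
theorem IsKnotClass.exists_unitLoop {κ : IsotopyClass} (hκ : IsKnotClass κ) :
    ∃ γ : UnitLoop, γ.IsSimple ∧ γ.knotType = κ := by
  obtain ⟨_, ⟨c, hc, hper, hinj, hne, rfl⟩, rfl⟩ := hκ
  have hcd : Differentiable ℝ c := hc.differentiable (by simp)
  have hc' : Continuous (deriv c) := hc.continuous_deriv (by simp)
  have hper' : Function.Periodic (deriv c) 1 := fun s => by
    rw [← deriv_comp_add_const]
    exact congrArg (fun f => deriv f s) (funext hper)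
  obtain ⟨L, τ, hL, hτd, hτ1, hτ0⟩ := exists_arclength_inverse (v := fun s => ‖deriv c s‖)
    hc'.norm (fun s => by simp only [hper' s]) (fun s => norm_pos_iff.2 (hne s))
  have hτ1' : τ 1 = 1 := by simpa [hτ0] using hτ1 0
  set f : ℝ → R3 := fun y => -(L⁻¹ • c 0) + L⁻¹ • c (τ y) with hf
  set g : ℝ → R3 := fun y => ‖deriv c (τ y)‖⁻¹ • deriv c (τ y) with hg
  have hg1 : ∀ y, ‖g y‖ = 1 := fun y => by
    rw [hg, norm_smul, norm_inv, norm_norm, inv_mul_cancel₀ (norm_ne_zero_iff.2 (hne _))]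
  have hfg : ∀ y, HasDerivAt f (g y) y := fun y => by
    have h1 := (((hcd (τ y)).hasDerivAt.scomp y (hτd y)).const_smul L⁻¹).const_add (-(L⁻¹ • c 0))
    have h2 : L⁻¹ • (L / ‖deriv c (τ y)‖) • deriv c (τ y) = g y := by
      rw [hg, smul_smul, div_eq_mul_inv, inv_mul_cancel_left₀ hL.ne']
    rw [h2] at h1
    exact h1
  have hgc : Continuous g :=
    ((hc'.comp τ.continuous).norm.inv₀ fun y => norm_ne_zero_iff.2 (hne _)).smul
      (hc'.comp τ.continuous)
  have hlip : LipschitzWith 1 f := lipschitzWith_of_nnnorm_deriv_le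
    (fun y => (hfg y).differentiableAt) fun y => by
      rw [(hfg y).deriv, ← NNReal.coe_le_coe, coe_nnnorm, hg1, NNReal.coe_one]
  have hfinj : InjOn f (Ico 0 1) := fun x hx y hy hxy => by
    have h1 : c (τ x) = c (τ y) :=
      smul_right_injective R3 (inv_ne_zero hL.ne') (add_left_cancel hxy)
    have hmem : ∀ z ∈ Ico (0 : ℝ) 1, τ z ∈ Ico (0 : ℝ) 1 := fun z hz =>
      ⟨by rw [← hτ0]; exact τ.monotone hz.1, by rw [← hτ1']; exact τ.strictMono hz.2⟩
    exact τ.injective (hinj (hmem x hx) (hmem y hy) h1)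
  obtain ⟨γ, hγ⟩ := exists_unitLoop_of_unit_speed (f := f) (g := g)
    (fun y => by simp only [hf, hτ1, hper (τ y)]) hlip
    (fun s _ => (hfg s).hasDerivWithinAt) hgc.continuousOn (fun s _ => hg1 s) hfinj
    ⟨0, by simp [hf, hτ0]⟩
  refine ⟨γ, by rw [UnitLoop.IsSimple, hγ]; exact hfinj, Quotient.sound (AmbientIsotopic.symm ?_)⟩
  obtain ⟨Φ, hΦ⟩ := exists_ambientIsotopy_affine (inv_pos.2 hL) (-(L⁻¹ • c 0))
  refine ⟨Φ, ?_⟩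
  rw [UnitLoop.carrier, hγ, ← τ.surjective.range_comp c, ← range_comp]
  congr 1
  ext1 y
  exact hΦ _

/-! ### Energies with separation and Hölder bounds -/

/-- Loops below a given energy level are separated at a common scale. -/
def HasUniformSeparation (𝓔 : UnitLoop → EReal) : Prop :=
  ∀ e : ℝ, ∃ δ : ℝ, 0 < δ ∧ ∀ γ : UnitLoop, 𝓔 γ < (e : EReal) → γ.IsSeparated δ

/-- Loops below a given energy level obey a common `C^{1,α}` bound. -/
def HasUniformHolderBound (𝓔 : UnitLoop → EReal) : Prop :=
  ∀ e : ℝ, ∃ (C : ℝ≥0) (α : ℝ), 0 < α ∧ α ≤ 1 ∧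
    ∀ γ : UnitLoop, 𝓔 γ ≤ (e : EReal) → γ.IsC1 ∧ γ.c1aNorm α ≤ (C : ℝ≥0∞)

/-- Compactness of the loops below an energy level; the limit has the eventual knot
type. -/
theorem exists_subseq_of_energy_le {𝓔 : UnitLoop → EReal}
    (h_i : HasUniformSeparation 𝓔)
    (h_iii : HasUniformHolderBound 𝓔)
    {e : ℝ} {γs : ℕ → UnitLoop} (he : ∀ i, 𝓔 (γs i) ≤ e) :
    ∃ (φ : ℕ → ℕ) (γ : UnitLoop), StrictMono φ ∧ γ.IsC1 ∧ γ.IsSimple ∧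
      TendstoC1 (fun i => γs (φ i)) γ ∧
      ∀ᶠ i in atTop, (γs (φ i)).knotType = γ.knotType := by
  obtain ⟨δ, hδ, hbi⟩ := h_i (e + 1)
  obtain ⟨C, α, hα, -, hreg⟩ := h_iii e
  have hlt : (e : EReal) < ((e + 1 : ℝ) : EReal) := EReal.coe_lt_coe_iff.2 (lt_add_one e)
  obtain ⟨φ, γ, hφ, h1, hsimple, hlim, c, hc, hlow⟩ := UnitLoop.exists_tendstoC1_subseq hα
    (fun i => (hreg _ (he i)).1) (fun i => (hreg _ (he i)).2) hδ
    (fun i => hbi _ ((he i).trans_lt hlt))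
  exact ⟨φ, γ, hφ, h1, hsimple, hlim,
    UnitLoop.eventually_knotType_eq (fun i => (hreg _ (he (φ i))).1) h1 hlim hc hlow⟩

theorem blowsUpAtSelfIntersections_of_separation {𝓔 : UnitLoop → EReal}
    (h_i : HasUniformSeparation 𝓔) :
    BlowsUpAtSelfIntersections 𝓔 := by
  rintro γs c - hlim ⟨s, hs, t, ht, hst, hc⟩
  have hs' := Ico_subset_Icc_self hs
  have ht' := Ico_subset_Icc_self ht
  refine EReal.tendsto_nhds_top_iff_real.2 fun e => ?_
  obtain ⟨δ, hδ, hbi⟩ := h_i (e + 1)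
  have hd := UnitLoop.intrinsicDist_pos hs ht hst
  have h0 : Tendsto (fun i => ‖γs i s - γs i t‖) atTop (𝓝 0) := by
    have := ((hlim.tendsto_at hs').sub (hlim.tendsto_at ht')).norm
    rwa [hc, sub_self, norm_zero] at this
  filter_upwards [h0.eventually (gt_mem_nhds (lt_min hδ (half_pos hd)))] with i hi
  have h1 : ¬ 𝓔 (γs i) < ((e + 1 : ℝ) : EReal) := fun h =>
    absurd (hbi _ h s hs' t ht' hd) (not_lt.2 hi.le)
  exact (EReal.coe_lt_coe_iff.2 (lt_add_one e)).trans_le (not_lt.1 h1)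

theorem isTightForAllKnottedArcs_of_separation_of_regularity {𝓔 : UnitLoop → EReal}
    (h_i : HasUniformSeparation 𝓔)
    (h_iii : HasUniformHolderBound 𝓔) :
    IsTightForAllKnottedArcs 𝓔 := by
  rintro γs a b x r ⟨hr, harc, hknot⟩
  refine EReal.tendsto_nhds_top_iff_real.2 fun e => ?_
  obtain ⟨δ, hδ, hbi⟩ := h_i (e + 1)
  obtain ⟨C, α, hα, -, hreg⟩ := h_iii e
  obtain ⟨η₀, hη₀, hmod⟩ := UnitLoop.exists_modulus hα C (ε := 1 / 16) (by norm_num)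
  set η := min η₀ (min (1 / 4) δ) with hη
  have hηpos : 0 < η := by positivity
  have hη1 : η ≤ η₀ := min_le_left _ _
  have hη2 : η ≤ 1 / 4 := (min_le_right _ _).trans (min_le_left _ _)
  have hη3 : η ≤ δ := (min_le_right _ _).trans (min_le_right _ _)
  filter_upwards [hr.eventually (gt_mem_nhds (show 0 < η / 4 by positivity))] with i hi
  by_contra hle
  have hle' := not_lt.1 hle
  obtain ⟨h1, hC⟩ := hreg _ hle'
  exact hknot i (UnitLoop.isTrivialBallArc_of_small h1 hηpos hη2 hη3
    (fun s hs t ht hst => hmod _ hC s hs t ht (hst.trans hη1))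
    (hbi _ (hle'.trans_lt (EReal.coe_lt_coe_iff.2 (lt_add_one e)))) (harc i) (by linarith))

theorem isStrong_of_separation_of_regularity {𝓔 : UnitLoop → EReal}
    (h_i : HasUniformSeparation 𝓔)
    (h_iii : HasUniformHolderBound 𝓔) :
    IsStrong 𝓔 := by
  intro e
  by_contra hinf
  obtain ⟨k⟩ : Nonempty (ℕ ↪ {κ : IsotopyClass | ∃ γ : UnitLoop, γ.IsSimple ∧
      𝓔 γ ≤ (e : EReal) ∧ γ.knotType = κ}) := ⟨Set.Infinite.natEmbedding _ hinf⟩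
  choose γs _ he hk using fun i => (k i).2
  obtain ⟨φ, γ, hφ, -, -, -, hev⟩ := exists_subseq_of_energy_le h_i h_iii he
  obtain ⟨N, hN⟩ := eventually_atTop.1 hev
  have h1 := (hN N le_rfl).trans (hN (N + 1) N.le_succ).symm
  rw [hk, hk] at h1
  exact absurd (hφ.injective (k.injective (Subtype.ext h1))) N.lt_succ_self.ne

theorem isMinimizable_of_separation_of_regularity {𝓔 : UnitLoop → EReal}
    (h_i : HasUniformSeparation 𝓔)
    (h_ii : ∀ (γs : ℕ → UnitLoop) (γ : UnitLoop), (∀ i, (γs i).IsC1) → γ.IsC1 →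
      TendstoC1 γs γ → 𝓔 γ ≤ liminf (fun i => 𝓔 (γs i)) atTop)
    (h_iii : HasUniformHolderBound 𝓔) :
    IsMinimizable 𝓔 := by
  intro κ hκ
  obtain ⟨γ₀, hγ₀, hκ₀⟩ := hκ.exists_unitLoop
  set S : Set EReal := 𝓔 '' {γ | γ.IsSimple ∧ γ.knotType = κ} with hS
  have hSle : ∀ β : UnitLoop, β.IsSimple → β.knotType = κ → sInf S ≤ 𝓔 β := fun β h1 h2 =>
    sInf_le (mem_image_of_mem _ ⟨h1, h2⟩)
  rcases eq_top_or_lt_top (sInf S) with htop | hlt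
  · -- All energies in the class are infinite.
    exact ⟨γ₀, hγ₀, hκ₀, fun β h1 h2 =>
      le_top.trans (htop ▸ hSle β h1 h2)⟩
  obtain ⟨e, he, -⟩ := EReal.lt_iff_exists_real_btwn.1 hlt
  obtain ⟨u, -, hu, huS⟩ := exists_seq_tendsto_sInf
    (show S.Nonempty from ⟨_, mem_image_of_mem _ ⟨hγ₀, hκ₀⟩⟩) (OrderBot.bddBelow S)
  obtain ⟨N, hN⟩ := eventually_atTop.1 (hu.eventually (gt_mem_nhds he))
  choose γs hγs hγu using huS
  obtain ⟨φ, γ, hφ, h1, hsimple, hlim, hev⟩ := exists_subseq_of_energy_le h_i h_iii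
    (γs := fun i => γs (i + N)) (e := e)
    (fun i => by rw [hγu]; exact (hN _ (Nat.le_add_left N i)).le)
  obtain ⟨i, hi⟩ := hev.exists
  refine ⟨γ, hsimple, hi.symm.trans (hγs _).2, fun β hβ1 hβ2 => ?_⟩
  obtain ⟨C, α, -, -, hreg⟩ := h_iii e
  have hlsc := h_ii _ γ (fun i => (hreg _ (by
    rw [hγu]; exact (hN _ (Nat.le_add_left N (φ i))).le)).1) h1 hlim
  have hlim' : Tendsto (fun i => 𝓔 (γs (φ i + N))) atTop (𝓝 (sInf S)) := by
    simp only [hγu]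
    exact hu.comp ((tendsto_add_atTop_nat N).comp hφ.tendsto_atTop)
  rw [hlim'.liminf_eq] at hlsc
  exact hlsc.trans (hSle β hβ1 hβ2)

theorem theorem2p1 (𝓔 : UnitLoop → EReal)
    (hbdd : ∃ m : ℝ, ∀ γ : UnitLoop, (m : EReal) ≤ 𝓔 γ)
    (h_i : ∀ e : ℝ, ∃ δ : ℝ, 0 < δ ∧ ∀ γ : UnitLoop, 𝓔 γ < (e : EReal) →
      ∀ s ∈ Icc (0 : ℝ) 1, ∀ t ∈ Icc (0 : ℝ) 1, 0 < intrinsicDist s t →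
        min δ (intrinsicDist s t / 2) < ‖γ s - γ t‖)
    (h_ii : ∀ (γs : ℕ → UnitLoop) (γ : UnitLoop), (∀ i, (γs i).IsC1) → γ.IsC1 →
      TendstoC1 γs γ → 𝓔 γ ≤ liminf (fun i => 𝓔 (γs i)) atTop)
    (h_iii : ∀ e : ℝ, ∃ (C : ℝ≥0) (α : ℝ), 0 < α ∧ α ≤ 1 ∧
      ∀ γ : UnitLoop, 𝓔 γ ≤ (e : EReal) → γ.IsC1 ∧ γ.c1aNorm α ≤ (C : ℝ≥0∞)) :
    BlowsUpAtSelfIntersections 𝓔 ∧ (IsFiniteOnSmooth 𝓔 → IsCharge 𝓔) ∧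
      IsMinimizable 𝓔 ∧ IsTight 𝓔 ∧ IsTightForAllKnottedArcs 𝓔 ∧ IsStrong 𝓔 := by
  have hblow := blowsUpAtSelfIntersections_of_separation h_i
  have htight := isTightForAllKnottedArcs_of_separation_of_regularity h_i h_iii
  refine ⟨hblow, fun hfin => ⟨hfin, hblow⟩,
    isMinimizable_of_separation_of_regularity h_i h_ii h_iii, ?_, htight,
    isStrong_of_separation_of_regularity h_i h_iii⟩
  rintro γs ⟨a, b, x, r, harcs, -⟩
  exact htight γs a b x r harcs
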